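/- Let $G$ be a totally disconnected, locally compact (Hausdorff) group, let $H$ be a closed subgroup of $G$, acting by conjugation, and let $K$ be a closed subgroup of $G$ normalized by $H$. Suppose that there is a closed normal subgroup $N$ of $H$ (possibly trivial) such that $H/N$ is compactly generated and $N$ has SIN action on $K$, i.e. every neighbourhood of $1$ in $K$ contains a neighbourhood of $1$ in $K$ that is invariant under conjugation by $N$. Notation. A subset of $K$ is $H$-invariant if every $h\in H$ conjugates it onto itself. For a closed $H$-invariant subgroup $D\le K$, a pair $(xD,yD)$ of points of $K/D$ is proximal if the closure in $K/D\times K/D$ of its orbit under the diagonal action of $H$ contains a point $(z,z)$; $H$ acts distally on $K/D$ if there is no proximal pair of distinct points, and distally at $1$ if there is no proximal pair $(xD,D)$ with $xD\ne D$. * $\mathrm{Dist}_K(H)$ (respectively $\mathrm{Dist}^*_K(H)$) is the intersection of all closed $H$-invariant subgroups $D$ of $K$ such that $H$ acts distally (respectively distally at $1$) on $K/D$. * For an $H$-invariant subgroup $L\le K$, $\mathrm{Res}_L(H)$ is the intersection of all $H$-invariant subgroups of $L$ that are open in $L$. Put $\mathrm{Res}^0_K(H)=K$, $\mathrm{Res}^{\alpha+1}_K(H)=\mathrm{Res}_{\mathrm{Res}^\alpha_K(H)}(H)$,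 and $\mathrm{Res}^{\alpha}_K(H)=\bigcap_{\beta<\alpha}\mathrm{Res}^\beta_K(H)$ for limit ordinals $\alpha>0$; $\mathrm{Res}^\infty_K(H)$ is the eventual value of this descending series. * A compact open subgroup $U$ of $K$ is tidy for an automorphism $\alpha$ of $K$ if $U=U_+U_-$, where $U_+=\bigcap_{n\ge0}\alpha^n(U)$ and $U_-=\bigcap_{n\le0}\alpha^n(U)$, and the set $U_{++}=\{g\in K : \alpha^n(g)\in U \text{ for all sufficiently negative } n\}$ is closed. The action of $H$ on $K$ is flat if some compact open subgroup of $K$ is tidy for (conjugation by) every $h\in H$; in that case $\mathrm{nub}_K(H)$ is the intersection of all such subgroups. Then the following are equivalent: (i) $\mathrm{Dist}_K(H)$ is compact; (ii) $\mathrm{Res}_K(H)$ is compact; (iii) $H$ normalizes a compact open subgroup of $K$. Moreover, if any of these conditions holds, then $H$ is flat on $K$ and $$\mathrm{nub}_K(H)=\mathrm{Res}_K(H)=\mathrm{Res}^\infty_K(H)=\mathrm{Dist}_K(H),$$ the group $\mathrm{nub}_K(H)$ is $H$-invariant and $H$ acts ergodically on it with respect to Haar measure $\mu$ (the action preserves $\mu$,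 and every Borel set $A$ with $\mu(hAh^{-1}\mathbin{\triangle}A)=0$ for all $h\in H$ is null or conull); and if $\mathrm{nub}_K(H)$ is metrizable, then $\mathrm{nub}_K(H)=\mathrm{Dist}^*_K(H)$. -/

import Mathlib

/-!
Throughout, a group `H` acts on a topological group `K` by automorphisms through a homomorphism
`φ : H →* MulAut K`.  In the theorem `K` is a closed subgroup of a t.d.l.c. group and `φ` is the
conjugation action of a subgroup normalizing `K`, so every `φ h` is a homeomorphism.
-/

namespace TDLC

open Filter Topology MeasureTheory
open scoped Pointwise

/-- The conjugation action `h ↦ (k ↦ h k h⁻¹)` on `K` of a subgroup `H` normalizing `K`. -/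
def conjAction {G : Type*} [Group G] (H K : Subgroup G)
    (hHK : H ≤ Subgroup.normalizer (K : Set G)) : H →* MulAut K :=
  K.normalizerMonoidHom.comp (Subgroup.inclusion hHK)

/-- A topological group is compactly generated if it is generated, as an abstract group, by a
compact subset. -/
def IsCompactlyGenerated (Q : Type*) [Group Q] [TopologicalSpace Q] : Prop :=
  ∃ S : Set Q, IsCompact S ∧ Subgroup.closure S = ⊤

section Tidy

variable {K : Type*} [Group K]

/-- `U₊ = ⋂_{n ≥ 0} αⁿ(U)`. -/
def plusPart (α : MulAut K) (U : Subgroup K) : Subgroup K :=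
  ⨅ n : ℕ, U.map (α ^ n).toMonoidHom

/-- `U₋ = ⋂_{n ≤ 0} αⁿ(U)`. -/
def minusPart (α : MulAut K) (U : Subgroup K) : Subgroup K :=
  ⨅ n : ℕ, U.map (α⁻¹ ^ n).toMonoidHom

/-- `U₊₊`, the set of `g` such that `αⁿ(g) ∈ U` for all sufficiently negative integers `n`. -/
def plusPlusPart (α : MulAut K) (U : Subgroup K) : Set K :=
  {g | ∃ m : ℤ, ∀ n : ℤ, n ≤ m → (α ^ n) g ∈ U}

/-- A compact open subgroup `U` is tidy for `α` if it is tidy above (`U = U₊ U₋`) and tidy below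
(`U₊₊` is closed). -/
structure IsTidy [TopologicalSpace K] (α : MulAut K) (U : Subgroup K) : Prop where
  isCompact : IsCompact (U : Set K)
  isOpen : IsOpen (U : Set K)
  tidyAbove : (U : Set K) = (plusPart α U : Set K) * (minusPart α U : Set K)
  tidyBelow : IsClosed (plusPlusPart α U)

end Tidy

section Action

variable {H K : Type*} [Group H] [Group K]

/-- A subset `X` is `H`-invariant: every element of `H` maps `X` onto itself. -/
def IsInvariant (φ : H →* MulAut K) (X : Set K) : Prop :=
  ∀ h : H, (φ h) '' X = X

/-- The action of `H` on an `H`-invariant subgroup. -/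
abbrev smulOn (φ : H →* MulAut K) (L : Subgroup K) (hL : IsInvariant φ (L : Set K)) : SMul H L where
  smul h x := ⟨φ h x, by
    have hx : φ h x ∈ (φ h) '' (L : Set K) := ⟨x, x.2, rfl⟩
    rwa [hL h] at hx⟩

variable [TopologicalSpace K]

/-- The action has small invariant neighbourhoods (SIN): there are arbitrarily small `H`-invariant
neighbourhoods of the identity. -/
def HasSIN (φ : H →* MulAut K) : Prop :=
  ∀ V ∈ 𝓝 (1 : K), ∃ W ∈ 𝓝 (1 : K), W ⊆ V ∧ IsInvariant φ W

/-- `U` is tidy for (every automorphism induced by) `H`. -/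
def IsTidyFor (φ : H →* MulAut K) (U : Subgroup K) : Prop :=
  ∀ h : H, IsTidy (φ h) U

/-- The action is flat: some compact open subgroup is tidy for `H`. -/
def IsFlat (φ : H →* MulAut K) : Prop :=
  ∃ U : Subgroup K, IsTidyFor φ U

/-- The nub of a flat action: the intersection of all subgroups that are tidy for `H`. -/
def nub (φ : H →* MulAut K) : Subgroup K :=
  sInf {U : Subgroup K | IsTidyFor φ U}

/-- For an `H`-invariant subgroup `D`, the pair of cosets `(xD, yD)` is proximal for the action
`h • xD = φ(h)(x)D` of `H` on `K/D`: the closure of its orbit under the diagonal action meets the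
diagonal of `K/D × K/D`. -/
def IsProximal (φ : H →* MulAut K) (D : Subgroup K) (x y : K) : Prop :=
  ∃ z : K ⧸ D, (z, z) ∈ closure
    (Set.range fun h : H => ((φ h x : K ⧸ D), (φ h y : K ⧸ D)))

/-- `H` acts distally on `K/D`: there is no proximal pair of distinct points. -/
def IsDistalOn (φ : H →* MulAut K) (D : Subgroup K) : Prop :=
  ∀ x y : K, IsProximal φ D x y → (x : K ⧸ D) = (y : K ⧸ D)

/-- `H` acts distally at `1` on `K/D`: no non-trivial coset forms a proximal pair with the trivial
coset. -/
def IsDistalAtOneOn (φ : H →* MulAut K) (D : Subgroup K) : Prop :=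
  ∀ x : K, IsProximal φ D x 1 → (x : K ⧸ D) = ((1 : K) : K ⧸ D)

/-- The distal residual `Dist_K(H)`. -/
def distalResidual (φ : H →* MulAut K) : Subgroup K :=
  sInf {D : Subgroup K | IsClosed (D : Set K) ∧ IsInvariant φ (D : Set K) ∧ IsDistalOn φ D}

/-- The `1`-distal residual `Dist*_K(H)`. -/
def oneDistalResidual (φ : H →* MulAut K) : Subgroup K :=
  sInf {D : Subgroup K | IsClosed (D : Set K) ∧ IsInvariant φ (D : Set K) ∧ IsDistalAtOneOn φ D}

/-- The discrete residual `Res_L(H)` of `H` on an `H`-invariant subgroup `L` of `K`, as a subgroup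
of `K`: the intersection of all `H`-invariant subgroups of `L` that are open in `L`. -/
def discreteResidualOn (φ : H →* MulAut K) (L : Subgroup K) : Subgroup K :=
  sInf {U : Subgroup K | U ≤ L ∧ IsOpen (U.subgroupOf L : Set L) ∧ IsInvariant φ (U : Set K)}

/-- The discrete residual `Res_K(H)`: the intersection of all open `H`-invariant subgroups. -/
def discreteResidual (φ : H →* MulAut K) : Subgroup K :=
  sInf {U : Subgroup K | IsOpen (U : Set K) ∧ IsInvariant φ (U : Set K)}

/-- `H` acts ergodically on the `H`-invariant subgroup `L`, with respect to (any choice of) Haar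
measure on `L`. -/
def IsErgodicOn (φ : H →* MulAut K) (L : Subgroup K) : Prop :=
  ∃ hL : IsInvariant φ (L : Set K),
    ∀ [MeasurableSpace L] [BorelSpace L] (μ : Measure L) [μ.IsHaarMeasure] [μ.Regular],
      letI := smulOn φ L hL
      ErgodicSMul H L μ

end Action

section Transfinite

universe u v

variable {H : Type v} {K : Type u} [Group H] [Group K] [TopologicalSpace K]

/-- The transfinite series `Res^α_K(H)`: `Res^0 = K`, `Res^{α+1} = Res_{Res^α}(H)`, and
intersections at limit ordinals. -/
noncomputable def residualSeries (φ : H →* MulAut K) (α : Ordinal.{u}) : Subgroup K :=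
  Ordinal.limitRecOn (motive := fun _ => Subgroup K) α ⊤
    (fun _ L => discreteResidualOn φ L)
    (fun α _ F => ⨅ (β : Ordinal.{u}) (hβ : β < α), F β hβ)

/-- `Res^∞_K(H)`: the eventual value of the descending series `Res^α_K(H)`, that is, the
intersection of all its terms (the series is stationary from some ordinal in the universe of `K`
on, since `K` has only a set of subgroups). -/
noncomputable def residualInfty (φ : H →* MulAut K) : Subgroup K :=
  ⨅ α : Ordinal.{u}, residualSeries φ α

end Transfinite

end TDLC

namespace TDLC

open Filter Topology MeasureTheory
open scoped Pointwise

/-! ### Invariant sets and the largest invariant subgroup of a subgroup -/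

section Invariance

variable {H K : Type*} [Group H] [Group K] {φ : H →* MulAut K}

/-! The hypotheses on `N` and `H/N` are used only to produce a generating set `S` of `H` that acts
equicontinuously. For a compact open subgroup `U`, let `U_n` (`wordCore`) be the group of points
kept in `U` by all words of length `n` in `S`. The `U_n` are open and descend to the invariant core
of `U`; if two consecutive terms agree, they equal the core, which is then open.

Suppose `Dist` is compact and contained in `U`. If the core were not open, a limit of points about
to leave `U` would give some `y` outside the core whose orbit accumulates at a point `z` of the core
(`exists_tendsto_of_not_isOpen_invariantCore`). By Ellis's theory of distal flows the same limit
transformation is onto core/`Dist`, so it also sends some `u` of the core to `z`; then `y` and `u`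
are proximal, a contradiction. So the core is open and `Res ≤ U`. Compact subgroups are
intersections of compact open ones, hence `Res = Dist`.

Suppose `Res` is compact and contained in `U`. The compact set `U \ U_1` misses `Res`, hence misses
a single open invariant subgroup `O`, and then `O ⊓ U` is invariant. The same argument shows that
`Res` has no proper relatively open invariant subgroup. This stops the transfinite series after one
step and yields ergodicity, through fixed vectors in `L²(Res)`. If ergodicity holds on a metrizable
group, almost every orbit accumulates at `1`, which gives the statement on `Dist*`.

For the nub: an automorphism preserving one compact open subgroup preserves every tidy one
(`IsTidy.map_eq`), so the tidy subgroups are exactly the invariant compact open ones. -/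

lemma apply_inv_apply (φ : H →* MulAut K) (h : H) (x : K) : φ h (φ h⁻¹ x) = x := by
  rw [← MulAut.mul_apply, ← map_mul, mul_inv_cancel, map_one, MulAut.one_apply]

lemma inv_apply_apply (φ : H →* MulAut K) (h : H) (x : K) : φ h⁻¹ (φ h x) = x := by
  simp

lemma isInvariant_iff {X : Set K} : IsInvariant φ X ↔ ∀ h, ∀ x ∈ X, φ h x ∈ X := by
  refine ⟨fun hX h x hx => ?_, fun hX h => ?_⟩
  · rw [← hX h]
    exact Set.mem_image_of_mem _ hx
  · refine Set.Subset.antisymm (Set.image_subset_iff.2 fun x hx => hX h x hx) fun x hx => ?_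
    exact ⟨φ h⁻¹ x, hX _ _ hx, apply_inv_apply φ h x⟩

lemma IsInvariant.apply_mem {X : Set K} (hX : IsInvariant φ X) (h : H) {x : K} (hx : x ∈ X) :
    φ h x ∈ X :=
  isInvariant_iff.1 hX h x hx

lemma IsInvariant.sInf {𝒮 : Set (Subgroup K)}
    (h𝒮 : ∀ U ∈ 𝒮, IsInvariant φ (U : Set K)) : IsInvariant φ ((sInf 𝒮 : Subgroup K) : Set K) := by
  refine isInvariant_iff.2 fun h x hx => ?_
  simp only [SetLike.mem_coe, Subgroup.mem_sInf] at hx ⊢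
  exact fun U hU => (h𝒮 U hU).apply_mem h (hx U hU)

lemma IsInvariant.inf {U V : Subgroup K} (hU : IsInvariant φ (U : Set K))
    (hV : IsInvariant φ (V : Set K)) : IsInvariant φ ((U ⊓ V : Subgroup K) : Set K) :=
  isInvariant_iff.2 fun h _ hx => ⟨hU.apply_mem h hx.1, hV.apply_mem h hx.2⟩

lemma IsInvariant.map_eq {W : Subgroup K} (hW : IsInvariant φ (W : Set K)) (h : H) :
    W.map (φ h).toMonoidHom = W :=
  SetLike.coe_injective (hW h)

/-- The largest `H`-invariant subgroup contained in `U`. -/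
def invariantCore (φ : H →* MulAut K) (U : Subgroup K) : Subgroup K :=
  ⨅ h : H, U.comap (φ h).toMonoidHom

lemma mem_invariantCore {U : Subgroup K} {x : K} :
    x ∈ invariantCore φ U ↔ ∀ h, φ h x ∈ U := by
  simp [invariantCore, Subgroup.mem_iInf]

lemma invariantCore_le (U : Subgroup K) : invariantCore φ U ≤ U := fun x hx => by
  simpa using mem_invariantCore.1 hx 1

lemma isInvariant_invariantCore (U : Subgroup K) :
    IsInvariant φ (invariantCore φ U : Set K) := by
  refine isInvariant_iff.2 fun h x hx => mem_invariantCore.2 fun g => ?_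
  simpa using mem_invariantCore.1 hx (g * h)

lemma le_invariantCore {U D : Subgroup K} (hD : IsInvariant φ (D : Set K)) (hDU : D ≤ U) :
    D ≤ invariantCore φ U :=
  fun _ hx => mem_invariantCore.2 fun h => hDU (hD.apply_mem h hx)

lemma isClosed_invariantCore [TopologicalSpace K] (hφ : ∀ h, Continuous (φ h)) {U : Subgroup K}
    (hU : IsClosed (U : Set K)) : IsClosed (invariantCore φ U : Set K) := by
  have : (invariantCore φ U : Set K) = ⋂ h, (φ h) ⁻¹' U := by
    ext x; simp [mem_invariantCore]
  rw [this]
  exact isClosed_iInter fun h => hU.preimage (hφ h)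

end Invariance

/-! ### Generating sets acting equicontinuously -/

section Generation

variable {H K : Type*} [Group H] [Group K] [TopologicalSpace K]

/-- `S` is a symmetric set of generators of `H` containing `1`, and the automorphisms induced by `S`
are equicontinuous at `1`. -/
structure IsEquicontinuousGenerating (φ : H →* MulAut K) (S : Set H) : Prop where
  one_mem : 1 ∈ S
  inv_mem : ∀ s ∈ S, s⁻¹ ∈ S
  closure_eq_top : Subgroup.closure S = ⊤
  mem_nhds : ∀ V ∈ 𝓝 (1 : K), {k | ∀ s ∈ S, φ s k ∈ V} ∈ 𝓝 (1 : K)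

variable {φ : H →* MulAut K} {S : Set H}

namespace IsEquicontinuousGenerating

lemma isInvariant (hS : IsEquicontinuousGenerating φ S) {X : Set K}
    (hX : ∀ s ∈ S, ∀ x ∈ X, φ s x ∈ X) : IsInvariant φ X := by
  refine isInvariant_iff.2 fun h => ?_
  have hh : h ∈ Subgroup.closure S := hS.closure_eq_top ▸ Subgroup.mem_top h
  induction hh using Subgroup.closure_induction'' with
  | mem s hs => exact hX s hs
  | inv_mem s hs => exact hX _ (hS.inv_mem s hs)
  | one => simp
  | mul a b _ _ ha hb => exact fun x hx => by simpa using ha _ (hb x hx)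

lemma pow_mem_nhds (hS : IsEquicontinuousGenerating φ S) (n : ℕ) {V : Set K}
    (hV : V ∈ 𝓝 (1 : K)) : {k | ∀ s ∈ S ^ n, φ s k ∈ V} ∈ 𝓝 (1 : K) := by
  induction n with
  | zero => simpa using hV
  | succ n ih =>
    refine mem_of_superset (hS.mem_nhds _ ih) fun k hk g hg => ?_
    rw [pow_succ] at hg
    obtain ⟨a, ha, b, hb, rfl⟩ := hg
    simpa using hk b hb a ha

lemma inv_mem_pow (hS : IsEquicontinuousGenerating φ S) (n : ℕ) {g : H} (hg : g ∈ S ^ n) :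
    g⁻¹ ∈ S ^ n := by
  have h : S⁻¹ = S := by
    ext s
    exact ⟨fun hs => by simpa using hS.inv_mem _ hs, fun hs => hS.inv_mem s hs⟩
  rw [← Set.mem_inv, ← inv_pow, h]
  exact hg

lemma exists_mem_pow (hS : IsEquicontinuousGenerating φ S) (h : H) : ∃ n, h ∈ S ^ n := by
  have hh : h ∈ Subgroup.closure S := hS.closure_eq_top ▸ Subgroup.mem_top h
  induction hh using Subgroup.closure_induction with
  | mem s hs => exact ⟨1, by simpa using hs⟩
  | inv s _ hs => exact hs.imp fun n hn => hS.inv_mem_pow n hn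
  | one => exact ⟨0, by simp⟩
  | mul a b _ _ ha hb =>
    obtain ⟨m, hm⟩ := ha
    obtain ⟨n, hn⟩ := hb
    exact ⟨m + n, pow_add S m n ▸ Set.mul_mem_mul hm hn⟩

end IsEquicontinuousGenerating

end Generation

/-! ### Compact open subgroups around a compact subgroup -/

section CompactOpen

variable {K : Type*} [Group K] [TopologicalSpace K] [IsTopologicalGroup K]

/-- Compactness gives a neighbourhood `V` of `1` with `V * C ⊆ C`; elements of `V ∩ V⁻¹` then
stabilize `C`. -/
lemma isOpen_stabilizer_of_isCompact_of_isOpen {C : Set K} (hC : IsCompact C) (hO : IsOpen C) :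
    IsOpen (MulAction.stabilizer K C : Set K) := by
  obtain ⟨V, hV, hVC⟩ := compact_open_separated_mul_left hC hO subset_rfl
  refine Subgroup.isOpen_of_mem_nhds _ (g := 1) ?_
  have hV' : V⁻¹ ∈ 𝓝 (1 : K) := inv_mem_nhds_one K hV
  filter_upwards [hV, hV'] with g hg hg'
  rw [SetLike.mem_coe, MulAction.mem_stabilizer_iff]
  refine Set.Subset.antisymm ?_ ?_
  · rintro _ ⟨c, hc, rfl⟩
    exact hVC (Set.mul_mem_mul hg hc)
  · intro c hc
    exact ⟨g⁻¹ * c, hVC (Set.mul_mem_mul hg' hc), by simp⟩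

/-- In a totally disconnected, locally compact group, every compact subgroup has a base of
neighbourhoods consisting of compact open subgroups. -/
lemma exists_compact_open_subgroup [T2Space K] [LocallyCompactSpace K]
    [TotallyDisconnectedSpace K] {D : Subgroup K} (hD : IsCompact (D : Set K)) {O : Set K}
    (hO : IsOpen O) (hDO : (D : Set K) ⊆ O) :
    ∃ U : Subgroup K, IsCompact (U : Set K) ∧ IsOpen (U : Set K) ∧ D ≤ U ∧ (U : Set K) ⊆ O := by
  obtain ⟨V, hV, hDV⟩ := compact_open_separated_mul_right hD hO hDO
  obtain ⟨B, hB, hB1⟩ := exists_compact_mem_nhds (1 : K)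
  obtain ⟨W, hW, hW1, hWVB⟩ := loc_compact_Haus_tot_disc_of_zero_dim.mem_nhds_iff.1
    (inter_mem hV hB1)
  have hWc : IsCompact W := hB.of_isClosed_subset hW.isClosed (hWVB.trans Set.inter_subset_right)
  have hC : IsCompact ((D : Set K) * W) := hD.mul hWc
  have hCo : IsOpen ((D : Set K) * W) := hW.isOpen.mul_left
  have hUo := isOpen_stabilizer_of_isCompact_of_isOpen hC hCo
  -- The set `D * W` contains `1`, so it contains every element of its stabilizer.
  have hUC : (MulAction.stabilizer K ((D : Set K) * W) : Set K) ⊆ D * W := by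
    intro g hg
    have h1 : (1 : K) ∈ (D : Set K) * W := ⟨1, D.one_mem, 1, hW1, by simp⟩
    have := Set.smul_mem_smul_set (a := g) h1
    rw [MulAction.mem_stabilizer_iff.1 hg] at this
    simpa using this
  refine ⟨_, hC.of_isClosed_subset (Subgroup.isClosed_of_isOpen _ hUo) hUC, hUo, ?_,
    hUC.trans ((Set.mul_subset_mul_left (hWVB.trans Set.inter_subset_left)).trans hDV)⟩
  intro d hd
  rw [MulAction.mem_stabilizer_iff, ← smul_mul_assoc, smul_coe_set hd]

/-- A compact subgroup is the intersection of the compact open subgroups that contain it. -/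
lemma exists_compact_open_subgroup_not_mem [T2Space K] [LocallyCompactSpace K]
    [TotallyDisconnectedSpace K] {D : Subgroup K} (hD : IsCompact (D : Set K)) {x : K}
    (hx : x ∉ D) :
    ∃ U : Subgroup K, IsCompact (U : Set K) ∧ IsOpen (U : Set K) ∧ D ≤ U ∧ x ∉ U := by
  obtain ⟨U, hUc, hUo, hDU, hU⟩ := exists_compact_open_subgroup hD (O := {x}ᶜ)
    isOpen_compl_singleton fun d hd h => hx (h ▸ hd)
  exact ⟨U, hUc, hUo, hDU, fun h => hU h rfl⟩

end CompactOpen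

/-! ### The filtration of a compact open subgroup by word length -/

section WordCore

variable {H K : Type*} [Group H] [Group K] {φ : H →* MulAut K} {S : Set H}

/-- The elements of `K` that every product of `n` elements of `S` maps into `U`. -/
def wordCore (φ : H →* MulAut K) (S : Set H) (U : Subgroup K) (n : ℕ) : Subgroup K :=
  ⨅ h ∈ S ^ n, U.comap (φ h).toMonoidHom

lemma mem_wordCore {U : Subgroup K} {n : ℕ} {x : K} :
    x ∈ wordCore φ S U n ↔ ∀ g ∈ S ^ n, φ g x ∈ U := by
  simp [wordCore, Subgroup.mem_iInf]

lemma invariantCore_le_wordCore (U : Subgroup K) (n : ℕ) :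
    invariantCore φ U ≤ wordCore φ S U n :=
  fun _ hx => mem_wordCore.2 fun g _ => mem_invariantCore.1 hx g

variable [TopologicalSpace K]

lemma wordCore_antitone (hS : IsEquicontinuousGenerating φ S) (U : Subgroup K) :
    Antitone (wordCore φ S U) :=
  fun _ _ hmn _ hx => mem_wordCore.2 fun g hg =>
    mem_wordCore.1 hx g (Set.pow_subset_pow_right hS.one_mem hmn hg)

lemma wordCore_le (hS : IsEquicontinuousGenerating φ S) (U : Subgroup K) (n : ℕ) :
    wordCore φ S U n ≤ U := fun x hx => by
  simpa using mem_wordCore.1 (wordCore_antitone hS U (Nat.zero_le n) hx) 1 (by simp)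

lemma isOpen_wordCore [IsTopologicalGroup K] (hS : IsEquicontinuousGenerating φ S)
    {U : Subgroup K} (hU : IsOpen (U : Set K)) (n : ℕ) :
    IsOpen (wordCore φ S U n : Set K) :=
  Subgroup.isOpen_of_mem_nhds _ (g := 1) <|
    mem_of_superset (hS.pow_mem_nhds n (hU.mem_nhds U.one_mem)) fun _ hx => mem_wordCore.2 hx

/-- If the chain stops at `n`, then for `s ∈ S` and `g ∈ S ^ n` the word `g * s` has length `n + 1`
and still maps `x` into `U`; so `S` preserves the `n`-th term. -/
lemma wordCore_le_invariantCore (hS : IsEquicontinuousGenerating φ S) {U : Subgroup K} {n : ℕ}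
    (h : wordCore φ S U n ≤ wordCore φ S U (n + 1)) :
    wordCore φ S U n ≤ invariantCore φ U := by
  refine le_invariantCore (hS.isInvariant fun s hs x hx => mem_wordCore.2 fun g hg => ?_)
    (wordCore_le hS U n)
  rw [← MulAut.mul_apply, ← map_mul]
  exact mem_wordCore.1 (h hx) _ (pow_succ S n ▸ Set.mul_mem_mul hg hs)

lemma iInf_wordCore_le_invariantCore (hS : IsEquicontinuousGenerating φ S) {U : Subgroup K}
    {x : K} (hx : ∀ n, x ∈ wordCore φ S U n) : x ∈ invariantCore φ U := by
  refine mem_invariantCore.2 fun h => ?_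
  obtain ⟨n, hn⟩ := hS.exists_mem_pow h
  exact mem_wordCore.1 (hx n) h hn

/-- If a compact open subgroup `U` meets the discrete residual in an `H`-invariant subgroup, then
it meets some open `H`-invariant subgroup in an `H`-invariant subgroup. -/
lemma exists_open_invariant_inf_isInvariant [IsTopologicalGroup K]
    (hS : IsEquicontinuousGenerating φ S) {U : Subgroup K}
    (hUc : IsCompact (U : Set K)) (hUo : IsOpen (U : Set K))
    (hRU : IsInvariant φ ((discreteResidual φ ⊓ U : Subgroup K) : Set K)) :
    ∃ O : Subgroup K, IsOpen (O : Set K) ∧ IsInvariant φ (O : Set K) ∧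
      IsInvariant φ ((O ⊓ U : Subgroup K) : Set K) := by
  have hV : IsOpen (wordCore φ S U 1 : Set K) := isOpen_wordCore hS hUo 1
  have hc : IsCompact ((U : Set K) \ wordCore φ S U 1) := hUc.diff hV
  let Z : {O : Subgroup K | IsOpen (O : Set K) ∧ IsInvariant φ (O : Set K)} → Set K :=
    fun O => (O.1 : Set K)
  -- Invariance of `discreteResidual φ ⊓ U` puts it inside `wordCore φ S U 1`. The open invariant
  -- subgroups are closed and directed downwards, so by compactness one of them already meets `U`
  -- inside `wordCore φ S U 1`.
  obtain ⟨⟨O, hO, hOinv⟩, hZ⟩ : ∃ O, ((U : Set K) \ wordCore φ S U 1) ∩ Z O = ∅ := by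
    have : Nonempty {O : Subgroup K | IsOpen (O : Set K) ∧ IsInvariant φ (O : Set K)} :=
      ⟨⊤, isOpen_univ, isInvariant_iff.2 fun _ _ _ => Subgroup.mem_top _⟩
    refine hc.elim_directed_family_closed Z
      (fun O => Subgroup.isClosed_of_isOpen _ O.2.1) ?_ ?_
    · rw [Set.eq_empty_iff_forall_notMem]
      rintro x ⟨⟨hxU, hxV⟩, hx⟩
      refine hxV (mem_wordCore.2 fun s _ => ?_)
      have hxR : x ∈ discreteResidual φ :=
        Subgroup.mem_sInf.2 fun O hO => Set.mem_iInter.1 hx ⟨O, hO⟩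
      exact (hRU.apply_mem s ⟨hxR, hxU⟩).2
    · rintro ⟨O, hO, hOi⟩ ⟨P, hP, hPi⟩
      exact ⟨⟨O ⊓ P, hO.inter hP, hOi.inf hPi⟩, fun x hx => hx.1, fun x hx => hx.2⟩
  refine ⟨O, hO, hOinv, hS.isInvariant fun s hs x hx => ⟨hOinv.apply_mem s hx.1, ?_⟩⟩
  by_contra hsx
  refine Set.eq_empty_iff_forall_notMem.1 hZ x ⟨⟨hx.2, fun h => hsx ?_⟩, hx.1⟩
  exact mem_wordCore.1 h s (by simpa using hs)

end WordCore

/-! ### The enveloping semigroup of a distal flow -/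

section Ellis

/-- Limits of the transformations of a distal flow on a compact space are surjective. -/
lemma exists_tendsto_of_distal {H X : Type*} [Group H] [TopologicalSpace X] [CompactSpace X]
    [T2Space X] (f : H → X → X) (hf : ∀ h, Continuous (f h))
    (hmul : ∀ g h x, f (g * h) x = f g (f h x))
    (hdist : ∀ x y, (∃ z, (z, z) ∈ closure (Set.range fun h => (f h x, f h y))) → x = y)
    (F : Ultrafilter H) (z : X) : ∃ u, Tendsto (fun h => f h u) F (𝓝 z) := by
  let _ : TopologicalSpace (Function.End X) := inferInstanceAs (TopologicalSpace (X → X))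
  have : T2Space (Function.End X) := inferInstanceAs (T2Space (X → X))
  have : CompactSpace (Function.End X) := inferInstanceAs (CompactSpace (X → X))
  have heval : ∀ x, Continuous fun p : Function.End X => p x := fun x => continuous_apply x
  let f' : H → Function.End X := f
  let E : Set (Function.End X) := closure (Set.range f')
  have hright : ∀ r : Function.End X, Continuous fun p : Function.End X => p * r := fun r =>
    continuous_pi fun x => heval (r x)
  have hleft : ∀ h, Continuous fun p : Function.End X => f' h * p := fun h =>
    continuous_pi fun x => (hf h).comp (heval x)
  -- Composition is continuous in the left factor always, but in the right factor only when the left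
  -- one is some `f' h`; hence two successive closure arguments.
  have hEmul : ∀ p ∈ E, ∀ q ∈ E, p * q ∈ E := by
    intro p hp q hq
    have h1 : ∀ h, f' h * q ∈ E := fun h => by
      refine closure_minimal (t := (fun p => f' h * p) ⁻¹' E) ?_
        (isClosed_closure.preimage (hleft h)) hq
      rintro _ ⟨g, rfl⟩
      exact subset_closure ⟨h * g, funext fun x => hmul h g x⟩
    refine closure_minimal (t := (fun p => p * q) ⁻¹' E) ?_
      (isClosed_closure.preimage (hright q)) hp
    rintro _ ⟨g, rfl⟩
    exact h1 g
  have hinj : ∀ p ∈ E, ∀ x y, p x = p y → x = y := by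
    intro p hp x y hxy
    refine hdist x y ⟨p x, ?_⟩
    have := map_mem_closure ((heval x).prodMk (heval y)) hp
      (t := Set.range fun h => (f h x, f h y)) (by rintro _ ⟨h, rfl⟩; exact ⟨h, rfl⟩)
    simpa [← hxy] using this
  have hsurj : ∀ p ∈ E, Function.Surjective p := by
    intro p hp
    -- The compact left ideal `E * p` contains an idempotent `q * p`. Being injective, it is the
    -- identity, so `q` is a left inverse of `p`; injectivity of `q` makes it a right inverse.
    obtain ⟨e, ⟨q, hq, rfl⟩, he⟩ := exists_idempotent_in_compact_subsemigroup hright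
      ((fun q => q * p) '' E) ⟨_, p, hp, rfl⟩
      ((isClosed_closure (s := Set.range f')).isCompact.image (hright p)) (by
        rintro _ ⟨a, ha, rfl⟩ _ ⟨b, hb, rfl⟩
        exact ⟨a * p * b, hEmul _ (hEmul _ ha _ hp) _ hb, by simp only [mul_assoc]⟩)
    have hqp : ∀ x, q (p x) = x := fun x =>
      hinj _ (hEmul _ hq _ hp) _ _ (congrFun he x)
    exact fun x => ⟨q x, hinj q hq _ _ (hqp (q x))⟩
  choose p hp using fun x : X => (isCompact_univ (X := X)).ultrafilter_le_nhds'
    (F.map fun h => f h x) univ_mem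
  have hpE : (p : Function.End X) ∈ E := by
    refine mem_closure_of_tendsto (f := f') (b := (F : Filter H)) ?_
      (Eventually.of_forall fun h => ⟨h, rfl⟩)
    exact tendsto_pi_nhds.2 fun x => (hp x).2
  obtain ⟨u, hu⟩ := hsurj _ hpE z
  exact ⟨u, hu ▸ (hp u).2⟩

end Ellis

/-! ### Distal actions on coset spaces and openness of invariant cores -/

section Distal

variable {H K : Type*} [Group H] [Group K] {φ : H →* MulAut K} {S : Set H}

/-- The transformation of `K/D` induced by `h`. -/
def cosetMap (φ : H →* MulAut K) (D : Subgroup K) (hD : IsInvariant φ (D : Set K)) (h : H) :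
    K ⧸ D → K ⧸ D :=
  Quotient.map' (φ h) fun a b hab => by
    rw [QuotientGroup.leftRel_apply] at hab ⊢
    simpa using hD.apply_mem h hab

@[simp]
lemma cosetMap_mk (D : Subgroup K) (hD : IsInvariant φ (D : Set K)) (h : H) (x : K) :
    cosetMap φ D hD h (x : K ⧸ D) = (φ h x : K ⧸ D) :=
  rfl

variable [TopologicalSpace K]

lemma continuous_cosetMap (hφ : ∀ h, Continuous (φ h)) (D : Subgroup K)
    (hD : IsInvariant φ (D : Set K)) (h : H) : Continuous (cosetMap φ D hD h) :=
  Continuous.quotient_map' (hφ h) _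

variable [IsTopologicalGroup K]

lemma t2Space_quotient {D : Subgroup K} (hD : IsClosed (D : Set K)) : T2Space (K ⧸ D) := by
  rw [t2Space_iff_of_isOpenQuotientMap QuotientGroup.isOpenQuotientMap_mk]
  have : {q : K × K | (q.1 : K ⧸ D) = q.2} = (fun q : K × K => q.1⁻¹ * q.2) ⁻¹' D := by
    ext q
    exact QuotientGroup.eq
  exact this ▸ hD.preimage (by fun_prop)

/-- If `H` acts distally on `K/D`, every point whose orbit accumulates at a compact invariant
subgroup `C ≥ D` belongs to `C`. -/
lemma mem_of_isDistalOn_of_tendsto (hφ : ∀ h, Continuous (φ h)) {C D : Subgroup K}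
    (hDcl : IsClosed (D : Set K)) (hD : IsInvariant φ (D : Set K)) (hdist : IsDistalOn φ D)
    (hC : IsCompact (C : Set K)) (hCinv : IsInvariant φ (C : Set K)) (hDC : D ≤ C)
    (F : Ultrafilter H) {y z : K} (hz : z ∈ C) (hyz : Tendsto (fun h => φ h y) F (𝓝 z)) :
    y ∈ C := by
  have := t2Space_quotient hDcl
  have hmk : Continuous ((↑) : K → K ⧸ D) := QuotientGroup.continuous_mk
  let X : Set (K ⧸ D) := (↑) '' (C : Set K)
  have : CompactSpace X := isCompact_iff_compactSpace.1 (hC.image hmk)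
  have hX : ∀ h, ∀ q ∈ X, cosetMap φ D hD h q ∈ X := by
    rintro h _ ⟨x, hx, rfl⟩
    exact ⟨φ h x, hCinv.apply_mem h hx, rfl⟩
  let f : H → X → X := fun h q => ⟨cosetMap φ D hD h q, hX h q q.2⟩
  obtain ⟨⟨_, u, hu, rfl⟩, hlim⟩ := exists_tendsto_of_distal f
    (fun h => ((continuous_cosetMap hφ D hD h).comp continuous_subtype_val).subtype_mk _)
    (by
      rintro g h ⟨_, x, hx, rfl⟩
      exact Subtype.ext (by simp [f]))
    (by
      rintro ⟨_, x, hx, rfl⟩ ⟨_, y, hy, rfl⟩ ⟨z, hz⟩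
      refine Subtype.ext (hdist x y ⟨z, ?_⟩)
      refine map_mem_closure (f := Prod.map Subtype.val Subtype.val)
        (continuous_subtype_val.prodMap continuous_subtype_val) hz ?_
      rintro _ ⟨h, rfl⟩
      exact ⟨h, rfl⟩)
    F ⟨_, z, hz, rfl⟩
  have h1 : Tendsto (fun h => (φ h u : K ⧸ D)) F (𝓝 (z : K ⧸ D)) :=
    (continuous_subtype_val.tendsto _).comp hlim
  have h2 : Tendsto (fun h => (φ h y : K ⧸ D)) F (𝓝 (z : K ⧸ D)) := (hmk.tendsto z).comp hyz
  -- Both orbits converge to `z` along the same ultrafilter, so the pair is proximal.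
  have h3 := hdist y u ⟨z, mem_closure_of_tendsto (h2.prodMk_nhds h1)
    (Eventually.of_forall fun h => ⟨h, rfl⟩)⟩
  have h4 := C.mul_mem hu (C.inv_mem (hDC (QuotientGroup.eq.1 h3)))
  simpa using h4

/-- If the invariant core of a compact open subgroup is not open, some element outside the core has
an orbit accumulating at the core. -/
lemma exists_tendsto_of_not_isOpen_invariantCore
    (hS : IsEquicontinuousGenerating φ S) {U : Subgroup K} (hUc : IsCompact (U : Set K))
    (hUo : IsOpen (U : Set K)) (hU : ¬ IsOpen (invariantCore φ U : Set K)) :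
    ∃ y, y ∉ invariantCore φ U ∧ ∃ z ∈ invariantCore φ U, ∃ F : Ultrafilter H,
      Tendsto (fun h => φ h y) F (𝓝 z) := by
  have hopen := isOpen_wordCore (φ := φ) hS hUo
  have hstrict : ∀ n, ∃ x ∈ wordCore φ S U n, x ∉ wordCore φ S U (n + 1) := by
    intro n
    by_contra! h
    exact hU (Subgroup.isOpen_mono (wordCore_le_invariantCore hS h) (hopen n))
  -- Points that some word of length `m` carries into the `m`-th term of the chain. A point lying in
  -- all `T m` has an orbit accumulating at the core.
  let T : ℕ → Set K := fun m => {y | ∃ a : H, a ∈ S ^ m ∧ φ a y ∈ wordCore φ S U m}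
  have hT : ∀ m, IsClosed (T m) := by
    intro m
    refine isClosed_of_closure_subset fun y hy => ?_
    -- Words of length `m` map the `(m + m)`-th term into the `m`-th one, so an error `v` in that
    -- term is harmless.
    obtain ⟨_, ⟨v, hv, rfl⟩, a, ha, hav⟩ := mem_closure_iff.1 hy
      (y • (wordCore φ S U (m + m) : Set K)) ((hopen _).smul y)
      ⟨1, Subgroup.one_mem _, by simp⟩
    refine ⟨a, ha, ?_⟩
    have hv' : φ a v ∈ wordCore φ S U m := mem_wordCore.2 fun g hg => by
      rw [← MulAut.mul_apply, ← map_mul]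
      exact mem_wordCore.1 hv _ (pow_add S m m ▸ Set.mul_mem_mul hg ha)
    simpa using Subgroup.mul_mem _ hav (Subgroup.inv_mem _ hv')
  -- Take `x` in the `n`-th term that a word `s * w` of length `n + 1` expels from `U`, and stop
  -- just before the exit, at `φ w x`. Undoing the last `m` letters of `w` leads back into the
  -- `m`-th term.
  have hy : ∀ n, ∃ y ∈ (U : Set K) \ wordCore φ S U 1, ∀ m ≤ n, y ∈ T m := by
    intro n
    obtain ⟨x, hx, hx'⟩ := hstrict n
    simp only [mem_wordCore, not_forall] at hx'
    obtain ⟨g, hg, hgx⟩ := hx'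
    rw [pow_succ'] at hg
    obtain ⟨s, hs, w, hw, rfl⟩ := hg
    refine ⟨φ w x, ⟨mem_wordCore.1 hx w hw, fun h => hgx ?_⟩, fun m hm => ?_⟩
    · simpa using mem_wordCore.1 h s (by simpa using hs)
    · rw [← Nat.add_sub_cancel' hm, pow_add] at hw
      obtain ⟨a, ha, b, hb, rfl⟩ := hw
      refine ⟨a⁻¹, hS.inv_mem_pow m ha, mem_wordCore.2 fun g hg => ?_⟩
      have := mem_wordCore.1 hx (g * b)
        (by rw [← Nat.add_sub_cancel' hm, pow_add]; exact Set.mul_mem_mul hg hb)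
      simpa using this
  choose y hyU hyT using hy
  -- The set `U \ wordCore φ S U 1` is compact, so the limit stays outside the core; it lies in
  -- every closed set `T m`.
  obtain ⟨y₀, hy₀, hlim⟩ := (hUc.diff (hopen 1)).ultrafilter_le_nhds'
    ((hyperfilter ℕ).map y) (Eventually.of_forall hyU : ∀ᶠ n in (hyperfilter ℕ : Filter ℕ), _)
  have hlim' : Tendsto y (hyperfilter ℕ : Filter ℕ) (𝓝 y₀) := hlim
  have hle : (hyperfilter ℕ : Filter ℕ) ≤ atTop := by
    simpa using Nat.hyperfilter_le_atTop
  have hy₀T : ∀ m, y₀ ∈ T m := fun m => (hT m).mem_of_tendsto hlim'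
    (hle ((eventually_ge_atTop m).mono fun n hn => hyT n m hn))
  choose a _ ha using hy₀T
  obtain ⟨z, -, hz⟩ := hUc.ultrafilter_le_nhds' ((hyperfilter ℕ).map fun m => φ (a m) y₀)
    (Eventually.of_forall fun m => wordCore_le hS U m (ha m) :
      ∀ᶠ n in (hyperfilter ℕ : Filter ℕ), _)
  have hz' : Tendsto (fun m => φ (a m) y₀) (hyperfilter ℕ : Filter ℕ) (𝓝 z) := hz
  refine ⟨y₀, fun h => hy₀.2 (invariantCore_le_wordCore U 1 h), z, ?_, (hyperfilter ℕ).map a, hz'⟩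
  refine iInf_wordCore_le_invariantCore hS fun n =>
    (Subgroup.isClosed_of_isOpen _ (hopen n)).mem_of_tendsto hz'
      (hle ((eventually_ge_atTop n).mono fun m hm => wordCore_antitone hS U hm (ha m)))

/-- If `H` acts distally on `K/D` with `D` compact, then the invariant core of every compact open
subgroup containing `D` is open. -/
theorem isOpen_invariantCore_of_isDistalOn [T2Space K] (hφ : ∀ h, Continuous (φ h))
    (hS : IsEquicontinuousGenerating φ S) {D : Subgroup K} (hDc : IsCompact (D : Set K))
    (hD : IsInvariant φ (D : Set K)) (hdist : IsDistalOn φ D) {U : Subgroup K}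
    (hUc : IsCompact (U : Set K)) (hUo : IsOpen (U : Set K)) (hDU : D ≤ U) :
    IsOpen (invariantCore φ U : Set K) := by
  by_contra hU
  obtain ⟨y, hy, z, hz, F, hF⟩ := exists_tendsto_of_not_isOpen_invariantCore hS hUc hUo hU
  exact hy (mem_of_isDistalOn_of_tendsto hφ hDc.isClosed hD hdist
    (hUc.of_isClosed_subset (isClosed_invariantCore hφ hUc.isClosed) (invariantCore_le U))
    (isInvariant_invariantCore U) (le_invariantCore hD hDU) F hz hF)

end Distal

/-! ### Comparison of the distal and discrete residuals -/

section Residuals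

variable {H K : Type*} [Group H] [Group K] [TopologicalSpace K] {φ : H →* MulAut K} {S : Set H}

lemma isInvariant_distalResidual : IsInvariant φ (distalResidual φ : Set K) :=
  IsInvariant.sInf fun _ hD => hD.2.1

lemma isClosed_distalResidual : IsClosed (distalResidual φ : Set K) := by
  rw [distalResidual, Subgroup.coe_sInf]
  exact isClosed_biInter fun D hD => hD.1

lemma isInvariant_discreteResidual : IsInvariant φ (discreteResidual φ : Set K) :=
  IsInvariant.sInf fun _ hU => hU.2

/-- Proximality passes to the further quotients `K/D`, where it forces equality; so distality
survives arbitrary intersections. -/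
lemma isDistalOn_distalResidual : IsDistalOn φ (distalResidual φ) := by
  rintro x y ⟨z, hz⟩
  refine QuotientGroup.eq.2 (Subgroup.mem_sInf.2 fun D hD => QuotientGroup.eq.1 ?_)
  have hle : distalResidual φ ≤ D := sInf_le hD
  have hcont : Continuous (Subgroup.quotientMapOfLE hle) :=
    Continuous.quotient_map' continuous_id _
  refine hD.2.2 x y ⟨Subgroup.quotientMapOfLE hle z, ?_⟩
  refine map_mem_closure (f := Prod.map _ _) (hcont.prodMap hcont) hz ?_
  rintro _ ⟨h, rfl⟩
  exact ⟨h, rfl⟩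

lemma oneDistalResidual_le_distalResidual : oneDistalResidual φ ≤ distalResidual φ :=
  sInf_le_sInf fun _ hD => ⟨hD.1, hD.2.1, fun x hx => hD.2.2 x 1 hx⟩

variable [IsTopologicalGroup K]

/-- The space `K/U` is discrete, so orbits in its square are closed, and `H` permutes cosets
injectively. -/
lemma isDistalOn_of_isOpen {U : Subgroup K} (hU : IsOpen (U : Set K))
    (hUinv : IsInvariant φ (U : Set K)) : IsDistalOn φ U := by
  have := QuotientGroup.discreteTopology hU
  rintro x y ⟨z, hz⟩
  rw [closure_discrete] at hz
  obtain ⟨h, hh⟩ := hz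
  obtain ⟨h1, h2⟩ := Prod.ext_iff.1 hh
  have := hUinv.apply_mem h⁻¹ (QuotientGroup.eq.1 (h1.trans h2.symm))
  refine QuotientGroup.eq.2 ?_
  simpa using this

lemma distalResidual_le_discreteResidual : distalResidual φ ≤ discreteResidual φ :=
  sInf_le_sInf fun U hU =>
    ⟨Subgroup.isClosed_of_isOpen U hU.1, hU.2, isDistalOn_of_isOpen hU.1 hU.2⟩

lemma isClosed_discreteResidual : IsClosed (discreteResidual φ : Set K) := by
  rw [discreteResidual, Subgroup.coe_sInf]
  exact isClosed_biInter fun U hU => Subgroup.isClosed_of_isOpen U hU.1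

lemma isCompact_discreteResidual {U : Subgroup K} (hUc : IsCompact (U : Set K))
    (hUo : IsOpen (U : Set K)) (hU : IsInvariant φ (U : Set K)) :
    IsCompact (discreteResidual φ : Set K) :=
  hUc.of_isClosed_subset isClosed_discreteResidual
    (sInf_le (a := U) ⟨hUo, hU⟩ : discreteResidual φ ≤ U)

variable [T2Space K] [LocallyCompactSpace K] [TotallyDisconnectedSpace K]

/-- A compact distal residual coincides with the discrete residual. -/
theorem discreteResidual_eq_distalResidual (hφ : ∀ h, Continuous (φ h))
    (hS : IsEquicontinuousGenerating φ S) (hc : IsCompact (distalResidual φ : Set K)) :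
    discreteResidual φ = distalResidual φ := by
  refine le_antisymm (fun x hx => ?_) distalResidual_le_discreteResidual
  by_contra hxD
  obtain ⟨U, hUc, hUo, hDU, hxU⟩ := exists_compact_open_subgroup_not_mem hc hxD
  have hopen := isOpen_invariantCore_of_isDistalOn hφ hS hc isInvariant_distalResidual
    isDistalOn_distalResidual hUc hUo hDU
  exact hxU (invariantCore_le U (Subgroup.mem_sInf.1 hx _ ⟨hopen, isInvariant_invariantCore U⟩))

/-- If the discrete residual is compact, every neighbourhood of it contains a compact open
`H`-invariant subgroup. -/
theorem exists_compact_open_invariant_le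
    (hS : IsEquicontinuousGenerating φ S) (hc : IsCompact (discreteResidual φ : Set K))
    {V : Set K} (hV : IsOpen V) (hRV : (discreteResidual φ : Set K) ⊆ V) :
    ∃ W : Subgroup K, IsCompact (W : Set K) ∧ IsOpen (W : Set K) ∧ IsInvariant φ (W : Set K) ∧
      (W : Set K) ⊆ V := by
  obtain ⟨U, hUc, hUo, hRU, hUV⟩ := exists_compact_open_subgroup hc hV hRV
  obtain ⟨O, hO, -, hOU⟩ := exists_open_invariant_inf_isInvariant hS hUc hUo (φ := φ)
    (by rw [inf_eq_left.2 hRU]; exact isInvariant_discreteResidual)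
  have hopen : IsOpen ((O ⊓ U : Subgroup K) : Set K) := hO.inter hUo
  exact ⟨O ⊓ U, hUc.of_isClosed_subset (Subgroup.isClosed_of_isOpen _ hopen) inf_le_right, hopen,
    hOU, fun x hx => hUV hx.2⟩

/-- A compact discrete residual has no proper relatively open `H`-invariant subgroup. -/
theorem discreteResidual_le_of_isOpen_subgroupOf
    (hS : IsEquicontinuousGenerating φ S) (hc : IsCompact (discreteResidual φ : Set K))
    {P : Subgroup K} (hPR : P ≤ discreteResidual φ)
    (hPo : IsOpen (P.subgroupOf (discreteResidual φ) : Set (discreteResidual φ)))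
    (hP : IsInvariant φ (P : Set K)) : discreteResidual φ ≤ P := by
  set R := discreteResidual φ with hR
  obtain ⟨V, hV, hVP⟩ := isOpen_induced_iff.1 hPo
  have hVP' : ∀ x ∈ R, x ∈ V ↔ x ∈ P := fun x hx => by
    have := Set.ext_iff.1 hVP ⟨x, hx⟩
    simpa [Subgroup.mem_subgroupOf] using this
  have hPcl : IsClosed (P : Set K) := by
    have h2 := hc.isClosed.isClosedEmbedding_subtypeVal.isClosedMap
      (P.subgroupOf R : Set R) (Subgroup.isClosed_of_isOpen (P.subgroupOf R) hPo)
    convert h2 using 1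
    ext x
    constructor
    · exact fun hx => ⟨⟨x, hPR hx⟩, hx, rfl⟩
    · rintro ⟨y, hy, rfl⟩
      exact hy
  have hPc : IsCompact (P : Set K) := hc.of_isClosed_subset hPcl hPR
  obtain ⟨U, hUc, hUo, hPU, hUV⟩ := exists_compact_open_subgroup hPc hV
    fun x hx => (hVP' x (hPR hx)).2 hx
  -- The group `P` is closed in `R`, hence compact, so `U` can be chosen to cut out exactly `P` from
  -- `R`; the invariance of `P` then yields an open invariant subgroup inside `U`, which must
  -- contain `R`.
  have hRU : R ⊓ U = P :=
    le_antisymm (fun x hx => (hVP' x hx.1).1 (hUV hx.2)) (le_inf hPR hPU)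
  obtain ⟨O, hO, -, hOU⟩ := exists_open_invariant_inf_isInvariant hS hUc hUo (φ := φ)
    (by rw [← hR, hRU]; exact hP)
  have hle : R ≤ O ⊓ U := sInf_le ⟨hO.inter hUo, hOU⟩
  exact hRU ▸ le_inf le_rfl (hle.trans inf_le_right)

end Residuals

/-! ### Stationarity of the transfinite residual series -/

section Transfinite

universe u v

variable {H : Type v} {K : Type u} [Group H] [Group K] [TopologicalSpace K]
  {φ : H →* MulAut K} {S : Set H}

lemma discreteResidualOn_top : discreteResidualOn φ ⊤ = discreteResidual φ := by
  rw [discreteResidualOn, discreteResidual]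
  congr 1
  ext U
  have : IsOpen (U.subgroupOf ⊤ : Set (⊤ : Subgroup K)) ↔ IsOpen (U : Set K) := by
    refine ⟨fun h => ?_, fun h => h.preimage continuous_subtype_val⟩
    have h' := h.preimage (f := fun x : K => (⟨x, Subgroup.mem_top x⟩ : (⊤ : Subgroup K)))
      (by fun_prop)
    exact h'
  simp [this]

lemma discreteResidualOn_le {L : Subgroup K} (hL : IsInvariant φ (L : Set K)) :
    discreteResidualOn φ L ≤ L :=
  sInf_le ⟨le_rfl, by simp, hL⟩

variable [IsTopologicalGroup K] [T2Space K] [LocallyCompactSpace K] [TotallyDisconnectedSpace K]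

lemma discreteResidualOn_discreteResidual (hS : IsEquicontinuousGenerating φ S)
    (hc : IsCompact (discreteResidual φ : Set K)) :
    discreteResidualOn φ (discreteResidual φ) = discreteResidual φ :=
  le_antisymm (discreteResidualOn_le isInvariant_discreteResidual)
    (le_sInf fun _ hP => discreteResidual_le_of_isOpen_subgroupOf hS hc hP.1 hP.2.1 hP.2.2)

theorem discreteResidual_eq_residualInfty (hS : IsEquicontinuousGenerating φ S)
    (hc : IsCompact (discreteResidual φ : Set K)) :
    discreteResidual φ = residualInfty φ := by
  have h1 : residualSeries φ 1 = discreteResidual φ := by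
    rw [← discreteResidualOn_top, ← zero_add (1 : Ordinal)]
    simp only [residualSeries, Ordinal.limitRecOn_add_one, Ordinal.limitRecOn_zero]
  have key : ∀ α : Ordinal.{u},
      residualSeries φ α = ⊤ ∨ residualSeries φ α = discreteResidual φ := by
    intro α
    induction α using Ordinal.limitRecOn with
    | zero => left; simp [residualSeries]
    | add_one α ih =>
      right
      have hs : residualSeries φ (α + 1) = discreteResidualOn φ (residualSeries φ α) := by
        simp only [residualSeries, Ordinal.limitRecOn_add_one]
      rw [hs]
      rcases ih with ih | ih
      · rw [ih, discreteResidualOn_top]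
      · rw [ih, discreteResidualOn_discreteResidual hS hc]
    | limit α hα ih =>
      right
      have hs : residualSeries φ α = ⨅ (β : Ordinal.{u}) (_ : β < α), residualSeries φ β := by
        simp only [residualSeries]
        rw [Ordinal.limitRecOn_limit _ _ _ _ hα]
      rw [hs]
      refine le_antisymm ?_ (le_iInf₂ fun β hβ => ?_)
      · exact (iInf₂_le (f := fun (β : Ordinal.{u}) (_ : β < α) => residualSeries φ β) 1
          (Ordinal.one_lt_of_isSuccLimit hα)).trans h1.le
      · rcases ih β hβ with h | h <;> simp [h]
  refine le_antisymm (le_iInf fun α => ?_) ((iInf_le _ 1).trans h1.le)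
  rcases key α with h | h <;> simp [h]

end Transfinite

/-! ### Tidy subgroups and automorphisms preserving a compact open subgroup -/

section Tidy

variable {K : Type*} [Group K]

lemma mem_map_mulAut {α : MulAut K} {A : Subgroup K} {x : K} :
    x ∈ A.map α.toMonoidHom ↔ α⁻¹ x ∈ A := by
  constructor
  · rintro ⟨y, hy, rfl⟩
    simpa using hy
  · exact fun hx => ⟨_, hx, by simp⟩

lemma mem_plusPart {α : MulAut K} {U : Subgroup K} {x : K} :
    x ∈ plusPart α U ↔ ∀ n : ℕ, (α ^ (-(n : ℤ))) x ∈ U := by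
  simp only [plusPart, Subgroup.mem_iInf, mem_map_mulAut, zpow_neg, zpow_natCast]

lemma mem_minusPart {α : MulAut K} {U : Subgroup K} {x : K} :
    x ∈ minusPart α U ↔ ∀ n : ℕ, (α ^ (n : ℤ)) x ∈ U := by
  simp only [minusPart, Subgroup.mem_iInf, mem_map_mulAut, inv_pow, inv_inv, zpow_natCast]

/-- The set `U₊₊` is a subgroup. -/
def plusPlusSubgroup (α : MulAut K) (U : Subgroup K) : Subgroup K where
  carrier := plusPlusPart α U
  one_mem' := ⟨0, fun n _ => by simp⟩
  mul_mem' := by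
    rintro a b ⟨m, hm⟩ ⟨k, hk⟩
    refine ⟨min m k, fun n hn => ?_⟩
    rw [map_mul]
    exact U.mul_mem (hm n (hn.trans (min_le_left _ _))) (hk n (hn.trans (min_le_right _ _)))
  inv_mem' := by
    rintro a ⟨m, hm⟩
    exact ⟨m, fun n hn => by rw [map_inv]; exact U.inv_mem (hm n hn)⟩

/-- Presents `U₊₊` as the union of the subgroups `αⁿ(U₊)`, the form needed for the Baire argument in
`IsTidy.map_eq`. -/
lemma mem_plusPlusSubgroup_iff {α : MulAut K} {U : Subgroup K} {x : K} :
    x ∈ plusPlusSubgroup α U ↔ ∃ n : ℕ, (α ^ (-(n : ℤ))) x ∈ plusPart α U := by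
  constructor
  · rintro ⟨m, hm⟩
    refine ⟨m.natAbs, mem_plusPart.2 fun n => ?_⟩
    rw [← MulAut.mul_apply, ← zpow_add]
    exact hm _ (by omega)
  · rintro ⟨n, hn⟩
    refine ⟨-n, fun k hk => ?_⟩
    have := mem_plusPart.1 hn (-n - k).toNat
    rw [← MulAut.mul_apply, ← zpow_add] at this
    convert this using 3
    omega

lemma map_zpow_eq {α : MulAut K} {W : Subgroup K} (hW : W.map α.toMonoidHom = W) (n : ℤ) :
    W.map (α ^ n).toMonoidHom = W := by
  have hst : α ∈ MulAction.stabilizer (MulAut K) W := hW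
  exact (MulAction.stabilizer (MulAut K) W).zpow_mem hst n

lemma relIndex_map_mulAut (α : MulAut K) (A B : Subgroup K) :
    (A.map α.toMonoidHom).relIndex (B.map α.toMonoidHom) = A.relIndex B :=
  Subgroup.relIndex_map_map_of_injective A B α.injective

/-- An automorphism that expands a subgroup `A`, and fixes a subgroup commensurate with `A`,
fixes `A`. -/
lemma map_eq_of_le_of_commensurate {α : MulAut K} {A W : Subgroup K}
    (hW : W.map α.toMonoidHom = W) (hA : A ≤ A.map α.toMonoidHom)
    (hAW : A.relIndex W ≠ 0) (hWA : W.relIndex A ≠ 0) : A.map α.toMonoidHom = A := by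
  set B := A.map α.toMonoidHom with hB
  -- Since `α` fixes `W`, passing from `A` to its image `B` changes neither relative index.
  -- Multiplicativity, with nonzero indices cancelled, gives first `A ⊓ W = B ⊓ W` and then `A = B`.
  have h1 : B.relIndex W = A.relIndex W := by
    conv_lhs => rw [← hW]
    exact relIndex_map_mulAut α A W
  have h2 : W.relIndex B = W.relIndex A := by
    conv_lhs => rw [← hW]
    exact relIndex_map_mulAut α W A
  have h3 : (A ⊓ W).relIndex (B ⊓ W) = 1 := by
    have := Subgroup.relIndex_mul_relIndex (A ⊓ W) (B ⊓ W) W (inf_le_inf_right W hA) inf_le_right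
    rw [Subgroup.inf_relIndex_right, Subgroup.inf_relIndex_right, h1] at this
    exact (mul_eq_right₀ hAW).1 this
  have h4 : W ⊓ B = W ⊓ A := by
    rw [inf_comm, inf_comm W]
    exact le_antisymm (Subgroup.relIndex_eq_one.1 h3) (inf_le_inf_right W hA)
  have h5 : A.relIndex B = 1 := by
    have := Subgroup.relIndex_mul_relIndex (W ⊓ A) A B inf_le_right hA
    rw [← h4, Subgroup.inf_relIndex_right, h4, Subgroup.inf_relIndex_right, h2] at this
    exact (mul_eq_left₀ hWA).1 this
  exact le_antisymm (Subgroup.relIndex_eq_one.1 h5) hA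

variable [TopologicalSpace K] [IsTopologicalGroup K]

lemma relIndex_ne_zero_of_isOpen_subgroupOf {A U : Subgroup K} (hU : IsCompact (U : Set K))
    (hA : IsOpen (A.subgroupOf U : Set U)) : A.relIndex U ≠ 0 := by
  have : CompactSpace U := isCompact_iff_compactSpace.1 hU
  have := Subgroup.quotient_finite_of_isOpen (A.subgroupOf U) hA
  exact (Subgroup.finiteIndex_of_finite_quotient (H := A.subgroupOf U)).index_ne_zero

/-- A compact open subgroup that is tidy for `α` is fixed by `α` as soon as `α` fixes some compact
open subgroup. -/
theorem IsTidy.map_eq [T2Space K] {α : MulAut K} (hα : ∀ n : ℤ, Continuous (α ^ n))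
    {U W : Subgroup K} (hU : IsTidy α U) (hWc : IsCompact (W : Set K)) (hWo : IsOpen (W : Set K))
    (hW : W.map α.toMonoidHom = W) : U.map α.toMonoidHom = U := by
  set A := plusPart α U with hAdef
  have hAU : A ≤ U := fun x hx => by simpa using mem_plusPart.1 hx 0
  have hWU : W.relIndex U ≠ 0 := relIndex_ne_zero_of_isOpen_subgroupOf hU.isCompact
    (hWo.preimage continuous_subtype_val)
  have hUW : U.relIndex W ≠ 0 := relIndex_ne_zero_of_isOpen_subgroupOf hWc
    (hU.isOpen.preimage continuous_subtype_val)
  have hWA : W.relIndex A ≠ 0 := mt (Subgroup.relIndex_eq_zero_of_le_right hAU) hWU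
  have hAcl : IsClosed (A : Set K) := by
    have : (A : Set K) = ⋂ n : ℕ, (α ^ (-(n : ℤ))) ⁻¹' U := by
      ext x; simp [hAdef, mem_plusPart]
    rw [this]
    exact isClosed_iInter fun n => hU.isCompact.isClosed.preimage (hα _)
  have hAexp : A ≤ A.map α.toMonoidHom := fun x hx => by
    refine mem_map_mulAut.2 (mem_plusPart.2 fun n => ?_)
    have := mem_plusPart.1 hx (n + 1)
    rw [← zpow_neg_one, ← MulAut.mul_apply, ← zpow_add]
    convert this using 3
    push_cast
    ring
  set P := plusPlusSubgroup α U with hP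
  have hAP : A ≤ P := fun x hx => mem_plusPlusSubgroup_iff.2 ⟨0, by simpa using hx⟩
  have hPmap : P.map α.toMonoidHom = P := by
    ext x
    rw [mem_map_mulAut, ← zpow_neg_one]
    constructor
    · rintro ⟨m, hm⟩
      refine ⟨m - 1, fun n hn => ?_⟩
      have := hm (n + 1) (by omega)
      rw [← MulAut.mul_apply, ← zpow_add] at this
      simpa using this
    · rintro ⟨m, hm⟩
      refine ⟨m + 1, fun n hn => ?_⟩
      rw [← MulAut.mul_apply, ← zpow_add]
      exact hm _ (by omega)
  -- Tidiness below makes `X` compact; it is fixed by `α` and will be shown commensurate with `A =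
  -- U₊`.
  set X := W ⊓ P with hX
  have hXmap : X.map α.toMonoidHom = X := by
    rw [hX, Subgroup.map_inf _ _ _ α.injective, hW, hPmap]
  have hXc : IsCompact (X : Set K) := hWc.inter_right hU.tidyBelow
  have hXA : X.relIndex A ≠ 0 := by
    rw [← Subgroup.inf_relIndex_right, hX, inf_assoc, inf_eq_right.2 hAP,
      Subgroup.inf_relIndex_right]
    exact hWA
  have hAX : A.relIndex X ≠ 0 := by
    have : CompactSpace X := isCompact_iff_compactSpace.1 hXc
    let f : ℕ → Subgroup X := fun n => (A.map (α ^ (n : ℤ)).toMonoidHom).subgroupOf X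
    have hf : ∀ n x, x ∈ f n ↔ (α ^ (-(n : ℤ))) (x : K) ∈ A := fun n x => by
      simp only [f, Subgroup.mem_subgroupOf, mem_map_mulAut, zpow_neg]
    -- Baire: the compact group `X` is a countable union of closed subgroups `αⁿ(A) ∩ X`, so one of
    -- them is open and has finite index; applying `α⁻ⁿ` gives the same for `A`.
    obtain ⟨n, x, hx⟩ := nonempty_interior_of_iUnion_of_closed (f := fun n => (f n : Set X))
      (fun n => by
        have : (f n : Set X) = (fun x : X => (α ^ (-(n : ℤ))) (x : K)) ⁻¹' A := by
          ext x; exact hf n x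
        rw [this]
        exact hAcl.preimage ((hα _).comp continuous_subtype_val))
      (Set.eq_univ_of_forall fun x => by
        obtain ⟨n, hn⟩ := mem_plusPlusSubgroup_iff.1 x.2.2
        exact Set.mem_iUnion.2 ⟨n, (hf n x).2 hn⟩)
    have hopen := Subgroup.isOpen_of_mem_nhds (f n) (mem_interior_iff_mem_nhds.1 hx)
    have := relIndex_ne_zero_of_isOpen_subgroupOf hXc hopen
    rwa [← map_zpow_eq hXmap n, relIndex_map_mulAut] at this
  have hA := map_eq_of_le_of_commensurate hXmap hAexp hAX hXA
  -- As `α` fixes `U₊`, it lies in `U₋`, so `U = U₊ U₋` is just `U₋`, which `α` maps into `U`.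
  have hUinv : U ≤ U.map (α⁻¹).toMonoidHom := by
    intro x hx
    have hx' : x ∈ (U : Set K) := hx
    rw [hU.tidyAbove] at hx'
    obtain ⟨a, ha, b, hb, rfl⟩ := hx'
    have ha' : a ∈ minusPart α U := mem_minusPart.2 fun n => by
      refine hAU ?_
      rw [← map_zpow_eq hA n]
      exact ⟨a, ha, rfl⟩
    rw [mem_map_mulAut, inv_inv]
    simpa using mem_minusPart.1 (Subgroup.mul_mem _ ha' hb) 1
  have hU' := map_eq_of_le_of_commensurate (by simpa using map_zpow_eq hW (-1)) hUinv hUW hWU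
  simpa using map_zpow_eq hU' (-1)

end Tidy

/-! ### The nub of an action preserving a compact open subgroup -/

section Nub

variable {H K : Type*} [Group H] [Group K] [TopologicalSpace K] [IsTopologicalGroup K]
  {φ : H →* MulAut K} {S : Set H}

lemma isTidyFor_of_isInvariant {U : Subgroup K} (hUc : IsCompact (U : Set K))
    (hUo : IsOpen (U : Set K)) (hU : IsInvariant φ (U : Set K)) : IsTidyFor φ U := by
  intro h
  have hmem : ∀ (n : ℤ) (x : K), (φ h ^ n) x ∈ U ↔ x ∈ U := fun n x => by
    rw [← map_zpow]
    refine ⟨fun hx => ?_, fun hx => hU.apply_mem _ hx⟩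
    simpa using hU.apply_mem (h ^ n)⁻¹ hx
  have hp : plusPart (φ h) U = U := by
    ext x
    rw [mem_plusPart]
    simp only [hmem, forall_const]
  have hm : minusPart (φ h) U = U := by
    ext x
    rw [mem_minusPart]
    simp only [hmem, forall_const]
  have hpp : plusPlusPart (φ h) U = U := by
    ext x
    simp only [plusPlusPart, hmem, Set.mem_ofPred_eq, SetLike.mem_coe]
    exact ⟨fun ⟨m, hm⟩ => hm m le_rfl, fun hx => ⟨0, fun _ _ => hx⟩⟩
  refine ⟨hUc, hUo, ?_, ?_⟩
  · rw [hp, hm, coe_mul_coe]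
  · rw [hpp]
    exact Subgroup.isClosed_of_isOpen U hUo

lemma IsTidyFor.isInvariant [T2Space K] (hφ : ∀ h, Continuous (φ h)) {U W : Subgroup K}
    (hU : IsTidyFor φ U) (hWc : IsCompact (W : Set K)) (hWo : IsOpen (W : Set K))
    (hW : IsInvariant φ (W : Set K)) : IsInvariant φ (U : Set K) := fun h => by
  have := (hU h).map_eq (fun n => by rw [← map_zpow]; exact hφ _) hWc hWo (hW.map_eq h)
  exact congrArg ((↑) : Subgroup K → Set K) this

theorem nub_eq_discreteResidual [T2Space K] [LocallyCompactSpace K] [TotallyDisconnectedSpace K]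
    (hφ : ∀ h, Continuous (φ h)) (hS : IsEquicontinuousGenerating φ S) {W : Subgroup K}
    (hWc : IsCompact (W : Set K)) (hWo : IsOpen (W : Set K)) (hW : IsInvariant φ (W : Set K)) :
    nub φ = discreteResidual φ := by
  refine le_antisymm (fun x hx => ?_) (le_sInf fun U hU => ?_)
  · by_contra hxR
    obtain ⟨U, hUc, hUo, hUinv, hUx⟩ := exists_compact_open_invariant_le hS
      (isCompact_discreteResidual hWc hWo hW) (V := {x}ᶜ) isOpen_compl_singleton
      fun r hr h => hxR (h ▸ hr)
    exact hUx (Subgroup.mem_sInf.1 hx U (isTidyFor_of_isInvariant hUc hUo hUinv)) rfl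
  · exact sInf_le ⟨(hU 1).isOpen, hU.isInvariant hφ hWc hWo hW⟩

end Nub

/-! ### Fixed vectors of isometric representations -/

section FixedVectors

section IsometricRepresentation

variable {G E : Type*} [Group G] [NormedAddCommGroup E] [InnerProductSpace ℝ E]
  (ρ : G →* (E →ₗᵢ[ℝ] E))

lemma rep_mul_apply (a b : G) (v : E) : ρ (a * b) v = ρ a (ρ b v) := by
  rw [map_mul]
  rfl

lemma rep_one_apply (v : E) : ρ 1 v = v := by
  rw [map_one]
  rfl

lemma rep_apply_inv_apply (a : G) (v : E) : ρ a (ρ a⁻¹ v) = v := by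
  rw [← rep_mul_apply, mul_inv_cancel, rep_one_apply]

lemma rep_inv_apply_apply (a : G) (v : E) : ρ a⁻¹ (ρ a v) = v := by
  rw [← rep_mul_apply, inv_mul_cancel, rep_one_apply]

end IsometricRepresentation

variable {H R E : Type*} [Group H] [Group R] [NormedAddCommGroup E] [InnerProductSpace ℝ E]

/-- The vectors fixed by a subgroup `P` in an isometric representation of `R`. -/
def fixedSpace (ρ : R →* (E →ₗᵢ[ℝ] E)) (P : Subgroup R) : Submodule ℝ E where
  carrier := {v | ∀ p ∈ P, ρ p v = v}
  zero_mem' := fun p _ => map_zero _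
  add_mem' := fun {v w} hv hw p hp => by rw [map_add, hv p hp, hw p hp]
  smul_mem' := fun c v hv p hp => by rw [map_smul, hv p hp]

variable {ρ : R →* (E →ₗᵢ[ℝ] E)}

lemma mem_fixedSpace {P : Subgroup R} {v : E} :
    v ∈ fixedSpace ρ P ↔ ∀ p ∈ P, ρ p v = v :=
  Iff.rfl

lemma mem_fixedSpace_sup {P Q : Subgroup R} {v : E} (hP : v ∈ fixedSpace ρ P)
    (hQ : v ∈ fixedSpace ρ Q) : v ∈ fixedSpace ρ (P ⊔ Q) := by
  intro p hp
  rw [Subgroup.sup_eq_closure] at hp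
  induction hp using Subgroup.closure_induction with
  | mem x hx => exact hx.elim (hP x) (hQ x)
  | one => exact rep_one_apply ρ v
  | mul x y _ _ hx hy => rw [rep_mul_apply, hy, hx]
  | inv x _ hx =>
    conv_lhs => rw [← hx]
    exact rep_inv_apply_apply ρ x v

lemma isClosed_fixedSpace (P : Subgroup R) : IsClosed (fixedSpace ρ P : Set E) := by
  have : (fixedSpace ρ P : Set E) = ⋂ p ∈ P, {v | ρ p v = v} := by
    ext v
    simp [mem_fixedSpace]
  rw [this]
  exact isClosed_biInter fun p _ => isClosed_eq (ρ p).continuous continuous_id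

/-- An invertible isometry intertwines the orthogonal projections onto subspaces that it
exchanges. -/
lemma starProjection_map_of_inverse {V W : Submodule ℝ E} [V.HasOrthogonalProjection]
    [W.HasOrthogonalProjection] (A B : E →ₗᵢ[ℝ] E) (hAB : ∀ v, A (B v) = v)
    (hA : ∀ v ∈ V, A v ∈ W) (hB : ∀ w ∈ W, B w ∈ V) (v : E) :
    W.starProjection (A v) = A (V.starProjection v) := by
  refine Submodule.eq_starProjection_of_mem_of_inner_eq_zero
    (hA _ (V.starProjection_apply_mem v)) fun w hw => ?_
  rw [← map_sub, ← hAB w, LinearIsometry.inner_map_map]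
  exact V.starProjection_inner_eq_zero v _ (hB w hw)

/-- The Bessel inequality for a family of projections of one vector. -/
lemma card_mul_le_norm_sq {ι : Type*} (s : Finset ι) (v : E) (V : ι → Submodule ℝ E)
    [∀ i, (V i).HasOrthogonalProjection] (c : ℝ)
    (hc : ∀ i ∈ s, ‖(V i).starProjection v‖ ^ 2 = c)
    (horth : ∀ i ∈ s, ∀ j ∈ s, i ≠ j →
      inner ℝ ((V i).starProjection v) ((V j).starProjection v) = 0) :
    s.card * c ≤ ‖v‖ ^ 2 := by
  classical
  set w := ∑ i ∈ s, (V i).starProjection v with hw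
  have h1 : inner ℝ v w = s.card * c := by
    rw [hw, inner_sum, Finset.sum_congr rfl (g := fun _ => c)]
    · simp
    · intro i hi
      rw [← hc i hi, ← real_inner_self_eq_norm_sq, Submodule.inner_starProjection_left_eq_right,
        (Submodule.starProjection_eq_self_iff).2 (Submodule.starProjection_apply_mem _ _)]
  have h2 : inner ℝ w w = s.card * c := by
    rw [hw, inner_sum, Finset.sum_congr rfl (g := fun _ => c)]
    · simp
    · intro i hi
      rw [sum_inner, Finset.sum_eq_single i, real_inner_self_eq_norm_sq, hc i hi]
      · exact fun j hj hji => horth j hj i hi hji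
      · exact fun h => absurd hi h
  have h3 : 0 ≤ ‖v - w‖ ^ 2 := sq_nonneg _
  rw [norm_sub_sq_real, h1, ← real_inner_self_eq_norm_sq w, h2] at h3
  linarith

variable [CompleteSpace E]

instance (P : Subgroup R) : (fixedSpace ρ P).HasOrthogonalProjection :=
  have : CompleteSpace (fixedSpace ρ P) := (isClosed_fixedSpace P).completeSpace_coe
  inferInstance

lemma apply_starProjection_fixedSpace {P : Subgroup R} [P.Normal] (r : R) (v : E) :
    (fixedSpace ρ P).starProjection (ρ r v) = ρ r ((fixedSpace ρ P).starProjection v) := by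
  have hfix : ∀ (r : R), ∀ v ∈ fixedSpace ρ P, ρ r v ∈ fixedSpace ρ P := by
    intro r v hv p hp
    have := hv (r⁻¹ * p * r) (by simpa using ‹P.Normal›.conj_mem p hp r⁻¹)
    conv_rhs => rw [← this, ← rep_mul_apply]
    rw [← rep_mul_apply]
    congr 2
    group
  exact starProjection_map_of_inverse (ρ r) (ρ r⁻¹) (rep_apply_inv_apply ρ r) (hfix r)
    (hfix r⁻¹) v

lemma starProjection_fixedSpace_mem {P Q : Subgroup R} [P.Normal] {v : E}
    (hv : v ∈ fixedSpace ρ Q) : (fixedSpace ρ P).starProjection v ∈ fixedSpace ρ Q := by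
  intro q hq
  rw [← apply_starProjection_fixedSpace, hv q hq]

/-- Move one projection across the inner product. Since `P` is normal, projecting to the `P`-fixed
vectors preserves `Q`-fixedness, so the composite lands in the vectors fixed by `P ⊔ Q`, to which
`v` is orthogonal. -/
lemma inner_starProjection_fixedSpace_eq_zero {P Q : Subgroup R} [P.Normal] {v : E}
    (hv : (fixedSpace ρ (P ⊔ Q)).starProjection v = 0) :
    inner ℝ ((fixedSpace ρ P).starProjection v) ((fixedSpace ρ Q).starProjection v) = 0 := by
  rw [Submodule.inner_starProjection_left_eq_right]
  rw [Submodule.starProjection_apply_eq_zero_iff] at hv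
  exact Submodule.inner_left_of_mem_orthogonal
    (mem_fixedSpace_sup ((fixedSpace ρ P).starProjection_apply_mem _)
      (starProjection_fixedSpace_mem ((fixedSpace ρ Q).starProjection_apply_mem v))) hv

/-- A vector that is nearly fixed by `P` is close to a vector fixed by `P`. -/
lemma exists_mem_fixedSpace_norm_sub_le {P : Subgroup R} {v : E} {ε : ℝ}
    (hv : ∀ p ∈ P, ‖v - ρ p v‖ ≤ ε) : ∃ w ∈ fixedSpace ρ P, ‖w - v‖ ≤ ε := by
  let C : Set E := {w | ∀ p ∈ P, ‖w - ρ p v‖ ≤ ε}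
  have hC : C = ⋂ p ∈ P, Metric.closedBall (ρ p v) ε := by
    ext w
    simp [C, dist_eq_norm]
  have hCcl : IsClosed C := hC ▸ isClosed_biInter fun p _ => Metric.isClosed_closedBall
  have hCconv : Convex ℝ C := hC ▸ convex_iInter₂ fun p _ => convex_closedBall _ _
  -- The vector of least norm in the closed convex `P`-stable set `C`; its translates have the same
  -- norm, so it is fixed by `P`.
  obtain ⟨w, hw, hmin⟩ := exists_norm_eq_iInf_of_complete_convex (K := C) ⟨v, hv⟩
    hCcl.isComplete hCconv 0
  rw [norm_eq_iInf_iff_real_inner_le_zero hCconv hw] at hmin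
  refine ⟨w, fun p hp => ?_, by simpa [rep_one_apply] using hw 1 P.one_mem⟩
  have hpw : ρ p w ∈ C := fun q hq => by
    have := hw (p⁻¹ * q) (P.mul_mem (P.inv_mem hp) hq)
    rw [← (ρ p).norm_map, map_sub, ← rep_mul_apply, mul_inv_cancel_left] at this
    exact this
  have h1 := hmin _ hpw
  rw [zero_sub, inner_neg_left, inner_sub_right, real_inner_self_eq_norm_sq] at h1
  have h2 : ‖w - ρ p w‖ ^ 2 ≤ 0 := by
    rw [norm_sub_sq_real, (ρ p).norm_map]
    linarith
  have h3 : w - ρ p w = 0 := by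
    rw [← norm_eq_zero]
    exact pow_eq_zero_iff two_ne_zero |>.1 (le_antisymm h2 (sq_nonneg _))
  exact (sub_eq_zero.1 h3).symm

variable {ψ : H →* MulAut R} {τ : H →* (E →ₗᵢ[ℝ] E)}

lemma starProjection_fixedSpace_map (hτ : ∀ h r v, τ h (ρ r v) = ρ (ψ h r) (τ h v))
    (P : Subgroup R) (h : H) (v : E) :
    (fixedSpace ρ (P.map (ψ h).toMonoidHom)).starProjection (τ h v) =
      τ h ((fixedSpace ρ P).starProjection v) := by
  refine starProjection_map_of_inverse (τ h) (τ h⁻¹) (rep_apply_inv_apply τ h) ?_ ?_ v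
  · rintro v hv _ ⟨p, hp, rfl⟩
    exact (hτ h p v).symm.trans (congrArg _ (hv p hp))
  · intro w hw p hp
    have := hτ h⁻¹ (ψ h p) w
    rw [show ρ (ψ h p) w = w from hw _ ⟨p, hp, rfl⟩, inv_apply_apply] at this
    exact this.symm

variable [TopologicalSpace R] [IsTopologicalGroup R] [CompactSpace R]

/-- If `R` has no proper open `H`-invariant subgroup, an `H`-fixed vector without `R`-fixed
component has no component fixed by an open normal subgroup. -/
lemma starProjection_fixedSpace_eq_zero (hψ : ∀ h, Continuous (ψ h))
    (hR : ∀ P : Subgroup R, IsOpen (P : Set R) → IsInvariant ψ (P : Set R) → P = ⊤)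
    (hτ : ∀ h r v, τ h (ρ r v) = ρ (ψ h r) (τ h v)) {v : E} (hv : ∀ h, τ h v = v)
    (hv₀ : (fixedSpace ρ (⊤ : Subgroup R)).starProjection v = 0) (P : Subgroup R) [P.Normal]
    (hP : IsOpen (P : Set R)) : (fixedSpace ρ P).starProjection v = 0 := by
  induction hn : P.index using Nat.strong_induction_on generalizing P with
  | _ n ih =>
  by_contra hne
  let T : H → Subgroup R := fun h => P.map (ψ h).toMonoidHom
  have hTnormal : ∀ h, (T h).Normal := fun h =>
    Subgroup.Normal.map inferInstance _ (ψ h).surjective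
  have hTopen : ∀ h, IsOpen (T h : Set R) := fun h => by
    have : (T h : Set R) = (ψ h⁻¹) ⁻¹' P := by
      ext x
      rw [SetLike.mem_coe, mem_map_mulAut, ← map_inv]
      rfl
    exact this ▸ hP.preimage (hψ _)
  have hTindex : ∀ h, (T h).index = n := fun h => by
    rw [← hn]
    exact Subgroup.index_map_equiv P (ψ h)
  have hTfin : ∀ h, (T h).FiniteIndex := fun h =>
    have := Subgroup.quotient_finite_of_isOpen (T h) (hTopen h)
    Subgroup.finiteIndex_of_finite_quotient
  have hTproj : ∀ h, (fixedSpace ρ (T h)).starProjection v =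
      τ h ((fixedSpace ρ P).starProjection v) := fun h => by
    conv_lhs => rw [← hv h]
    exact starProjection_fixedSpace_map hτ P h v
  have horth : ∀ Q ∈ Set.range T, ∀ Q' ∈ Set.range T, Q ≠ Q' →
      inner ℝ ((fixedSpace ρ Q).starProjection v) ((fixedSpace ρ Q').starProjection v) = 0 := by
    rintro _ ⟨g, rfl⟩ _ ⟨h, rfl⟩ hne'
    have := hTnormal g
    have := hTnormal h
    have := hTfin g
    have := hTfin h
    refine inner_starProjection_fixedSpace_eq_zero (ih (T g ⊔ T h).index ?_ (T g ⊔ T h)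
      (Subgroup.isOpen_mono le_sup_left (hTopen g)) rfl)
    -- Distinct translates of `P` have the same finite index, so neither contains the other; the
    -- join has smaller index and the induction hypothesis applies to it.
    have hlt : T g < T g ⊔ T h := by
      refine lt_of_le_of_ne le_sup_left fun heq => ?_
      have hle : T h ≤ T g := heq ▸ le_sup_right
      have := Subgroup.index_strictAnti (lt_of_le_of_ne hle hne'.symm)
      rw [hTindex, hTindex] at this
      exact lt_irrefl _ this
    exact (Subgroup.index_strictAnti hlt).trans_eq (hTindex g)
  have hcpos : 0 < ‖(fixedSpace ρ P).starProjection v‖ ^ 2 := by positivity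
  -- The projections of `v` attached to distinct translates are orthogonal and of equal nonzero
  -- norm, so Bessel's inequality bounds their number. The intersection of all translates is then
  -- open and invariant.
  have hfinite : (Set.range T).Finite := by
    by_contra hinf
    obtain ⟨N, hN⟩ := exists_nat_gt (‖v‖ ^ 2 / ‖(fixedSpace ρ P).starProjection v‖ ^ 2)
    obtain ⟨s, hs, hsN⟩ := Set.Infinite.exists_subset_card_eq hinf N
    have := card_mul_le_norm_sq s v (fun Q => fixedSpace ρ Q)
      (‖(fixedSpace ρ P).starProjection v‖ ^ 2)
      (fun Q hQ => by
        obtain ⟨h, rfl⟩ := hs hQ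
        rw [hTproj, LinearIsometry.norm_map])
      (fun Q hQ Q' hQ' => horth Q (hs hQ) Q' (hs hQ'))
    rw [div_lt_iff₀ hcpos, ← hsN] at hN
    exact absurd this (not_le.2 hN)
  have hcore : sInf (Set.range T) = ⊤ := by
    refine hR _ ?_ (isInvariant_iff.2 fun g x hx => ?_)
    · rw [Subgroup.coe_sInf]
      refine hfinite.isOpen_biInter ?_
      rintro _ ⟨h, rfl⟩
      exact hTopen h
    · refine Subgroup.mem_sInf.2 ?_
      rintro _ ⟨h, rfl⟩
      have := Subgroup.mem_sInf.1 hx _ ⟨g⁻¹ * h, rfl⟩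
      rw [mem_map_mulAut, ← map_inv] at this ⊢
      simpa using this
  have hPtop : P = ⊤ := by
    refine top_le_iff.1 (hcore.symm.le.trans (sInf_le ⟨1, ?_⟩))
    ext x
    rw [mem_map_mulAut]
    simp
  subst hPtop
  exact hne hv₀

/-- If `R` has no proper open `H`-invariant subgroup, then in a continuous isometric representation
of `R ⋊ H` every `H`-fixed vector is `R`-fixed. -/
theorem mem_fixedSpace_top_of_fixed (hψ : ∀ h, Continuous (ψ h))
    (hR : ∀ P : Subgroup R, IsOpen (P : Set R) → IsInvariant ψ (P : Set R) → P = ⊤)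
    (hτ : ∀ h r v, τ h (ρ r v) = ρ (ψ h r) (τ h v)) {v : E} (hv : ∀ h, τ h v = v)
    (hcont : ∀ ε > 0, ∃ P : Subgroup R, P.Normal ∧ IsOpen (P : Set R) ∧
      ∀ p ∈ P, ‖v - ρ p v‖ ≤ ε) : v ∈ fixedSpace ρ (⊤ : Subgroup R) := by
  set V := fixedSpace ρ (⊤ : Subgroup R) with hV
  -- It suffices to kill the component orthogonal to the `R`-fixed vectors. It is nearly fixed by
  -- small open normal `P`, hence close to a `P`-fixed vector, yet orthogonal to all of these.
  set w := v - V.starProjection v with hw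
  have hwτ : ∀ h, τ h w = w := fun h => by
    have := starProjection_fixedSpace_map hτ (⊤ : Subgroup R) h v
    rw [hv h, Subgroup.map_top_of_surjective _ (ψ h).surjective] at this
    rw [hw, map_sub, hv h, ← this]
  have hw₀ : V.starProjection w = 0 := by
    rw [hw, map_sub, Submodule.starProjection_eq_self_iff.2 (V.starProjection_apply_mem v),
      sub_self]
  have hzero : ‖w‖ = 0 := by
    refine le_antisymm (le_of_forall_pos_le_add fun ε hε => ?_) (norm_nonneg w)
    obtain ⟨P, hPn, hPo, hP⟩ := hcont ε hε
    have hwP := starProjection_fixedSpace_eq_zero hψ hR hτ hwτ hw₀ P hPo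
    obtain ⟨u, hu, huw⟩ := exists_mem_fixedSpace_norm_sub_le (ρ := ρ) (P := P) (v := w) (ε := ε)
      fun p hp => by
        have h1 : ρ p (V.starProjection v) = V.starProjection v :=
          V.starProjection_apply_mem v p (Subgroup.mem_top p)
        rw [hw, map_sub, h1, sub_sub_sub_cancel_right]
        exact hP p hp
    rw [Submodule.starProjection_apply_eq_zero_iff] at hwP
    have h2 : inner ℝ u w = 0 := Submodule.inner_right_of_mem_orthogonal hu hwP
    have h3 := norm_sub_sq_real u w
    rw [h2] at h3
    rw [zero_add]
    refine le_trans ?_ huw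
    nlinarith [norm_nonneg w, norm_nonneg (u - w), sq_nonneg ‖u‖]
  rw [norm_eq_zero, hw, sub_eq_zero] at hzero
  exact hzero ▸ V.starProjection_apply_mem v

end FixedVectors

/-! ### Koopman representations and ergodicity on profinite groups -/

section Ergodicity

variable {H R : Type*} [Group H] [Group R] [TopologicalSpace R] [IsTopologicalGroup R]
  [CompactSpace R] [MeasurableSpace R] [BorelSpace R] {ψ : H →* MulAut R}

/-- A Borel set of a compact group that is almost invariant under all translations is null or
conull. -/
lemma eventuallyConst_of_translation_invariant (μ : Measure R) [μ.IsHaarMeasure] [μ.Regular]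
    {A : Set R} (hA : MeasurableSet A) (h : ∀ r : R, (fun x => r * x) ⁻¹' A =ᵐ[μ] A) :
    EventuallyConst A (ae μ) := by
  have hinv : (μ.restrict A).IsMulLeftInvariant := ⟨fun r => by
    ext s hs
    rw [Measure.map_apply (measurable_const_mul r) hs, Measure.restrict_apply hs,
      Measure.restrict_apply (hs.preimage (measurable_const_mul r)),
      ← measure_preimage_mul μ r (s ∩ A), Set.preimage_inter]
    exact measure_congr ((ae_eq_refl _).inter (h r).symm)⟩
  have hreg : (μ.restrict A).Regular := inferInstance
  -- By uniqueness of Haar measure, `μ` restricted to `A` is a multiple `c` of `μ`: `A` is null if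
  -- `c = 0`, and otherwise its complement is.
  have key := Measure.isMulLeftInvariant_eq_smul_of_regular (μ.restrict A) μ
  set c := Measure.haarScalarFactor (μ.restrict A) μ
  have h1 : c • μ Aᶜ = 0 := by
    have := congrArg (fun ν : Measure R => ν Aᶜ) key
    simpa [hA] using this.symm
  rw [eventuallyConst_set']
  rcases eq_or_ne c 0 with hc | hc
  · left
    rw [hc, zero_smul, Measure.restrict_eq_zero] at key
    rwa [ae_eq_empty]
  · right
    rw [ae_eq_univ]
    simpa [ENNReal.smul_def, hc] using h1

lemma measurePreserving_mulAut (hψ : ∀ h, Continuous (ψ h)) (μ : Measure R) [μ.IsHaarMeasure]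
    (h : H) : MeasurePreserving (ψ h) μ μ :=
  MonoidHom.measurePreserving (f := (ψ h).toMonoidHom) (hψ h) (ψ h).surjective rfl

section Koopman

variable {X G : Type*} [MeasurableSpace X] [Group G] {μ : Measure X}

lemma compMeasurePreserving_comp {f g : X → X} (hf : MeasurePreserving f μ μ)
    (hg : MeasurePreserving g μ μ) (v : Lp ℝ 2 μ) :
    Lp.compMeasurePreserving f hf (Lp.compMeasurePreserving g hg v) =
      Lp.compMeasurePreserving (g ∘ f) (hg.comp hf) v := by
  rcases v with ⟨⟨v⟩, hv⟩
  rfl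

lemma compMeasurePreserving_congr {f g : X → X} (hf : MeasurePreserving f μ μ)
    (hg : MeasurePreserving g μ μ) (h : f = g) (v : Lp ℝ 2 μ) :
    Lp.compMeasurePreserving f hf v = Lp.compMeasurePreserving g hg v := by
  subst h
  rfl

lemma compMeasurePreserving_of_eq_id {f : X → X} (hf : MeasurePreserving f μ μ) (h : f = id)
    (v : Lp ℝ 2 μ) : Lp.compMeasurePreserving f hf v = v := by
  subst h
  rcases v with ⟨⟨v⟩, hv⟩
  rfl

/-- The Koopman representation on `L²` of a group of measure preserving permutations. -/
noncomputable def koopman (θ : G →* Equiv.Perm X) (hθ : ∀ g, MeasurePreserving (θ g) μ μ) :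
    G →* (Lp ℝ 2 μ →ₗᵢ[ℝ] Lp ℝ 2 μ) where
  -- Precomposition reverses products; the inverse restores the order.
  toFun g := Lp.compMeasurePreservingₗᵢ ℝ (θ g⁻¹) (hθ g⁻¹)
  map_one' := LinearIsometry.ext fun v =>
    compMeasurePreserving_of_eq_id (hθ 1⁻¹) (by simp) v
  map_mul' a b := LinearIsometry.ext fun v => by
    refine Eq.trans ?_ (compMeasurePreserving_comp (hθ a⁻¹) (hθ b⁻¹) v).symm
    exact compMeasurePreserving_congr _ _ (by simp) v

end Koopman

/-- Let `H` act by continuous automorphisms on a profinite group `R` without proper open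
`H`-invariant subgroups. Then the action is ergodic. -/
theorem eventuallyConst_of_forall_preimage_ae_eq [TotallyDisconnectedSpace R]
    (hψ : ∀ h, Continuous (ψ h))
    (hR : ∀ P : Subgroup R, IsOpen (P : Set R) → IsInvariant ψ (P : Set R) → P = ⊤)
    (μ : Measure R) [μ.IsHaarMeasure] [μ.Regular] {A : Set R} (hA : MeasurableSet A)
    -- The indicator of `A` is an `H`-fixed vector of `L²`; once it is `R`-fixed, `A` is almost
    -- invariant under all translations.
    (h : ∀ h, (ψ h) ⁻¹' A =ᵐ[μ] A) : EventuallyConst A (ae μ) := by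
  let ρ := koopman (μ := μ) (MulAction.toPermHom R R) fun r => measurePreserving_mul_left μ r
  let τ := koopman (μ := μ) ((MulAut.toPerm R).comp ψ) (measurePreserving_mulAut hψ μ)
  have hτ : ∀ h r v, τ h (ρ r v) = ρ (ψ h r) (τ h v) := by
    intro h r v
    refine (compMeasurePreserving_comp _ _ v).trans
      (Eq.trans ?_ (compMeasurePreserving_comp _ _ v).symm)
    refine compMeasurePreserving_congr _ _ (funext fun x => ?_) v
    change r⁻¹ * ψ h⁻¹ x = ψ h⁻¹ ((ψ h r)⁻¹ * x)
    rw [← map_inv (ψ h) r, map_mul, inv_apply_apply]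
  let v : Lp ℝ 2 μ := indicatorConstLp 2 hA (measure_ne_top μ A) 1
  have hv : ∀ h, τ h v = v := fun g => by
    refine (Lp.indicatorConstLp_compMeasurePreserving hA (measure_ne_top μ A) (1 : ℝ) _).trans ?_
    exact (indicatorConstLp_inj _ _ _ _ one_ne_zero).2 (h g⁻¹)
  have hcont : Continuous fun r => ρ r v := by
    let g : R → C(R, R) := fun r => (ContinuousMap.mk fun q : R × R => q.1⁻¹ * q.2).curry r
    exact Continuous.compMeasurePreservingLp (f := fun _ : R => v) (g := g) continuous_const
      (ContinuousMap.continuous _) (fun r => measurePreserving_mul_left μ r⁻¹) (by simp)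
  have hfix := mem_fixedSpace_top_of_fixed hψ hR hτ hv fun ε hε => by
    have hopen : IsOpen {r | ‖v - ρ r v‖ < ε} :=
      isOpen_lt (continuous_const.sub hcont).norm continuous_const
    obtain ⟨P, hP⟩ := ProfiniteGrp.exist_openNormalSubgroup_sub_open_nhds_of_one hopen
      (by simpa [rep_one_apply] using hε)
    exact ⟨P.toSubgroup, P.isNormal', P.isOpen', fun p hp => (hP hp).le⟩
  refine eventuallyConst_of_translation_invariant μ hA fun r => ?_
  have h1 := hfix r⁻¹ (Subgroup.mem_top _)
  have h2 := (Lp.indicatorConstLp_compMeasurePreserving hA (measure_ne_top μ A) (1 : ℝ)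
    (measurePreserving_mul_left μ r)).symm.trans
      ((compMeasurePreserving_congr _ _ (funext fun x => by simp) v).trans h1)
  exact (indicatorConstLp_inj _ _ _ _ one_ne_zero).1 h2

end Ergodicity

/-! ### Ergodicity on the residual and its effect on distality at `1` -/

section ErgodicOnResidual

variable {H K : Type*} [Group H] [Group K] {φ : H →* MulAut K} {S : Set H}

/-- The action of `H` by automorphisms of an `H`-invariant subgroup. -/
def restrictAction (φ : H →* MulAut K) (L : Subgroup K) (hL : IsInvariant φ (L : Set K)) :
    H →* MulAut L where
  toFun h :=
    { toFun := fun x => ⟨φ h x, hL.apply_mem h x.2⟩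
      invFun := fun x => ⟨φ h⁻¹ x, hL.apply_mem h⁻¹ x.2⟩
      left_inv := fun x => Subtype.ext (inv_apply_apply φ h x)
      right_inv := fun x => Subtype.ext (apply_inv_apply φ h x)
      map_mul' := fun x y => Subtype.ext (map_mul (φ h) (x : K) y) }
  map_one' := by
    ext x
    simp
  map_mul' g h := by
    ext x
    simp

variable [TopologicalSpace K] [IsTopologicalGroup K]

/-- If `H` acts ergodically on a compact metrizable subgroup `L`, then `L` is contained in every
closed invariant subgroup `D` such that `H` acts distally at `1` on `K/D`. -/
theorem IsErgodicOn.le_of_isDistalAtOneOn (hφ : ∀ h, Continuous (φ h)) {L D : Subgroup K}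
    (hLc : IsCompact (L : Set K)) [TopologicalSpace.MetrizableSpace L] (hL : IsErgodicOn φ L)
    (hD : IsClosed (D : Set K)) (hdist : IsDistalAtOneOn φ D) : L ≤ D := by
  obtain ⟨hLinv, herg⟩ := hL
  have : CompactSpace L := isCompact_iff_compactSpace.1 hLc
  let _ : MeasurableSpace L := borel L
  have : BorelSpace L := ⟨rfl⟩
  let μ : Measure L := Measure.haar
  let _ := smulOn φ L hLinv
  have hμ : ErgodicSMul H L μ := herg μ
  have hsmul : ∀ (h : H) (x : L), ((h • x : L) : K) = φ h x := fun _ _ => rfl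
  have hcont : ∀ h : H, Continuous fun x : L => h • x := fun h =>
    ((hφ h).comp continuous_subtype_val).subtype_mk _
  -- The points whose orbit meets `O` form an invariant open set containing `O`; it is not null, so
  -- it is conull.
  have hmeet : ∀ O : Set L, IsOpen O → O.Nonempty → ∀ᵐ x ∂μ, ∃ h : H, h • x ∈ O := by
    intro O hO hne
    let A : Set L := {x | ∃ h : H, h • x ∈ O}
    have hAo : IsOpen A := by
      have : A = ⋃ h : H, (fun x : L => h • x) ⁻¹' O := by
        ext x
        simp [A]
      exact this ▸ isOpen_iUnion fun h => hO.preimage (hcont h)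
    have hOA : O ⊆ A := fun x hx => ⟨1, by
      have : (1 : H) • x = x := Subtype.ext (by simp [hsmul])
      rwa [this]⟩
    have hmul : ∀ (g h : H) (x : L), g • h • x = (g * h) • x := fun g h x =>
      Subtype.ext (by simp [hsmul])
    have hAinv : ∀ g : H, (fun x : L => g • x) ⁻¹' A = A := by
      intro g
      ext x
      constructor
      · rintro ⟨h, hh⟩
        exact ⟨h * g, hmul h g x ▸ hh⟩
      · rintro ⟨h, hh⟩
        refine ⟨h * g⁻¹, ?_⟩
        rw [hmul, inv_mul_cancel_right]
        exact hh
    have hconst := hμ.aeconst_of_forall_preimage_smul_ae_eq hAo.measurableSet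
      fun g => EventuallyEq.of_eq (hAinv g)
    rcases eventuallyConst_set.1 hconst with h | h
    · exact h
    · have hnull : μ A = 0 := by
        rw [measure_eq_zero_iff_ae_notMem]
        exact h
      have := (hO.measure_eq_zero_iff μ).1 (measure_mono_null hOA hnull)
      exact absurd this hne.ne_empty
  obtain ⟨O, hO, hbasis⟩ := (nhds_basis_opens (1 : L)).exists_antitone_subbasis
  -- Along a countable base at `1`, almost every orbit accumulates at `1`, so almost every `x` is
  -- proximal to `1` and lies in `D`. A closed conull set is everything.
  have hae : ∀ᵐ x ∂μ, x ∈ D.subgroupOf L := by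
    have : ∀ᵐ x ∂μ, ∀ n, ∃ h : H, h • x ∈ O n :=
      ae_all_iff.2 fun n => hmeet (O n) (hO n).2 ⟨1, (hO n).1⟩
    filter_upwards [this] with x hx
    have hcl : (1 : L) ∈ closure (Set.range fun h : H => h • x) := by
      refine (mem_closure_iff_nhds_basis hbasis.toHasBasis).2 fun n _ => ?_
      obtain ⟨h, hh⟩ := hx n
      exact ⟨_, ⟨h, rfl⟩, hh⟩
    have hprox : IsProximal φ D x 1 := by
      refine ⟨((1 : K) : K ⧸ D), ?_⟩
      have hmk : Continuous fun y : L => (((y : K) : K ⧸ D), ((1 : K) : K ⧸ D)) :=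
        (QuotientGroup.continuous_mk.comp continuous_subtype_val).prodMk continuous_const
      refine map_mem_closure (f := fun y : L => (((y : K) : K ⧸ D), ((1 : K) : K ⧸ D))) hmk hcl ?_
      rintro _ ⟨h, rfl⟩
      exact ⟨h, by simp [hsmul]⟩
    have := QuotientGroup.eq.1 (hdist x hprox)
    simpa [Subgroup.mem_subgroupOf] using this
  have hDcl : IsClosed (D.subgroupOf L : Set L) := hD.preimage continuous_subtype_val
  have hempty := (hDcl.isOpen_compl.measure_eq_zero_iff μ).1 (mem_ae_iff.1 hae)
  intro x hx
  have : (⟨x, hx⟩ : L) ∈ (D.subgroupOf L : Set L) := by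
    rw [Set.compl_empty_iff.1 hempty]
    trivial
  exact this

variable [T2Space K] [LocallyCompactSpace K] [TotallyDisconnectedSpace K]

lemma eq_top_of_isOpen_of_isInvariant_restrictAction (hS : IsEquicontinuousGenerating φ S)
    (hc : IsCompact (discreteResidual φ : Set K)) (P : Subgroup (discreteResidual φ))
    (hPo : IsOpen (P : Set (discreteResidual φ)))
    (hP : IsInvariant (restrictAction φ _ isInvariant_discreteResidual)
      (P : Set (discreteResidual φ))) : P = ⊤ := by
  let R := discreteResidual φ
  have hPR : (P.map R.subtype).subgroupOf R = P :=
    Subgroup.comap_map_eq_self_of_injective R.subtype_injective P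
  have hle : R ≤ P.map R.subtype := by
    refine discreteResidual_le_of_isOpen_subgroupOf hS hc (Subgroup.map_subtype_le P) ?_
      (isInvariant_iff.2 ?_)
    · exact hPR.symm ▸ hPo
    · rintro h _ ⟨x, hx, rfl⟩
      exact ⟨_, hP.apply_mem h hx, rfl⟩
  rw [← hPR]
  exact Subgroup.subgroupOf_eq_top.2 hle

theorem isErgodicOn_discreteResidual (hφ : ∀ h, Continuous (φ h))
    (hS : IsEquicontinuousGenerating φ S) (hc : IsCompact (discreteResidual φ : Set K)) :
    IsErgodicOn φ (discreteResidual φ) := by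
  refine ⟨isInvariant_discreteResidual, fun {_} _ μ _ _ => ?_⟩
  have : CompactSpace (discreteResidual φ) := isCompact_iff_compactSpace.1 hc
  let ψ := restrictAction φ (discreteResidual φ) isInvariant_discreteResidual
  have hψ : ∀ h, Continuous (ψ h) := fun h =>
    ((hφ h).comp continuous_subtype_val).subtype_mk _
  let _ := smulOn φ (discreteResidual φ) isInvariant_discreteResidual
  have : SMulInvariantMeasure H (discreteResidual φ) μ :=
    ⟨fun h _ hs => (measurePreserving_mulAut hψ μ h).measure_preimage hs.nullMeasurableSet⟩
  exact ⟨fun hs hinv => eventuallyConst_of_forall_preimage_ae_eq hψ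
    (eq_top_of_isOpen_of_isInvariant_restrictAction hS hc) μ hs hinv⟩

end ErgodicOnResidual

/-! ### Equicontinuous generation for the conjugation action -/

section Conjugation

/-- A compact subset of a quotient of a locally compact group is covered by the image of a compact
set. -/
lemma exists_isCompact_image_quotient {Q : Type*} [Group Q] [TopologicalSpace Q]
    [IsTopologicalGroup Q] [LocallyCompactSpace Q] (N : Subgroup Q) {C : Set (Q ⧸ N)}
    (hC : IsCompact C) : ∃ B : Set Q, IsCompact B ∧ C ⊆ (↑) '' B := by
  choose B hB hBn using fun q : Q => exists_compact_mem_nhds q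
  obtain ⟨t, -, ht⟩ := hC.elim_nhds_subcover (fun q => ((↑) : Q → Q ⧸ N) '' B q.out) fun q _ => by
    have := QuotientGroup.isOpenMap_coe (N := N) |>.image_mem_nhds (hBn q.out)
    rwa [QuotientGroup.out_eq'] at this
  refine ⟨⋃ q ∈ t, B q.out, t.isCompact_biUnion fun q _ => hB _, ht.trans ?_⟩
  simp only [Set.image_iUnion]
  rfl

variable {G : Type*} [Group G] {H K : Subgroup G} {hHK : H ≤ Subgroup.normalizer (K : Set G)}

variable [TopologicalSpace G] [IsTopologicalGroup G]

lemma continuous_conjAction_uncurry :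
    Continuous fun q : K × H => conjAction H K hHK q.2 q.1 := by
  refine continuous_induced_rng.2 ?_
  have : Continuous fun q : K × H => (q.2 : G) * q.1 * (q.2 : G)⁻¹ := by fun_prop
  exact this

lemma continuous_conjAction (h : H) : Continuous (conjAction H K hHK h) :=
  continuous_conjAction_uncurry.comp (Continuous.prodMk_left h)

lemma forall_conjAction_mem_nhds_of_isCompact {C : Set H} (hC : IsCompact C) {V : Set K}
    (hV : V ∈ 𝓝 (1 : K)) : {k | ∀ c ∈ C, conjAction H K hHK c k ∈ V} ∈ 𝓝 (1 : K) := by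
  refine hC.eventually_forall_of_forall_eventually (P := fun k c => conjAction H K hHK c k ∈ V)
    fun c _ => ?_
  refine (continuous_conjAction_uncurry (hHK := hHK)).continuousAt.eventually_mem ?_
  simpa using hV

/-- Generators are `N` and a symmetrized compact lift `B` of generators of `H/N`: small invariant
neighbourhoods handle `N`, joint continuity and compactness handle `B` and `B⁻¹`. -/
theorem exists_isEquicontinuousGenerating [LocallyCompactSpace H]
    {N : Subgroup H} [N.Normal] (hSIN : HasSIN ((conjAction H K hHK).comp N.subtype))
    (hcg : IsCompactlyGenerated (H ⧸ N)) :
    ∃ S, IsEquicontinuousGenerating (conjAction H K hHK) S := by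
  obtain ⟨C, hC, hCtop⟩ := hcg
  obtain ⟨B, hB, hCB⟩ := exists_isCompact_image_quotient N hC
  let S : Set H := N ∪ (B ∪ B⁻¹)
  refine ⟨S, Or.inl N.one_mem, ?_, ?_, fun V hV => ?_⟩
  · rintro s (hs | hs | hs)
    · exact Or.inl (N.inv_mem hs)
    · exact Or.inr (Or.inr (by simpa using hs))
    · exact Or.inr (Or.inl hs)
  · have hmap : (Subgroup.closure S).map (QuotientGroup.mk' N) = ⊤ := by
      rw [← top_le_iff, ← hCtop, Subgroup.closure_le]
      intro q hq
      obtain ⟨b, hb, rfl⟩ := hCB hq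
      exact ⟨b, Subgroup.subset_closure (Or.inr (Or.inl hb)), rfl⟩
    refine (Subgroup.eq_top_iff' _).2 fun h => ?_
    obtain ⟨s, hs, hsh⟩ : QuotientGroup.mk' N h ∈ (Subgroup.closure S).map (QuotientGroup.mk' N) :=
      hmap ▸ Subgroup.mem_top _
    have hn : s⁻¹ * h ∈ N := QuotientGroup.eq.1 hsh
    have := (Subgroup.closure S).mul_mem hs (Subgroup.subset_closure (Or.inl hn))
    simpa using this
  · obtain ⟨W, hW, hWV, hWinv⟩ := hSIN V hV
    filter_upwards [hW, forall_conjAction_mem_nhds_of_isCompact (hHK := hHK) hB hV,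
      forall_conjAction_mem_nhds_of_isCompact (hHK := hHK) hB.inv hV] with k hk hk' hk'' s hs
    rcases hs with hs | hs | hs
    · exact hWV (hWinv.apply_mem (⟨s, hs⟩ : N) hk)
    · exact hk' s hs
    · exact hk'' s hs

end Conjugation

end TDLC

/-! ### Assembly of the main theorem -/

theorem mainTheorem5 {G : Type*} [Group G] [TopologicalSpace G] [IsTopologicalGroup G]
    [T2Space G] [LocallyCompactSpace G] [TotallyDisconnectedSpace G]
    (H K : Subgroup G) (hH : IsClosed (H : Set G)) (hK : IsClosed (K : Set G))
    (hHK : H ≤ Subgroup.normalizer (K : Set G))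
    (hN : ∃ (N : Subgroup H) (_ : N.Normal), IsClosed (N : Set H) ∧
      TDLC.HasSIN ((TDLC.conjAction H K hHK).comp N.subtype) ∧
      TDLC.IsCompactlyGenerated (H ⧸ N)) :
    List.TFAE
      [IsCompact (TDLC.distalResidual (TDLC.conjAction H K hHK) : Set K),
       IsCompact (TDLC.discreteResidual (TDLC.conjAction H K hHK) : Set K),
       ∃ U : Subgroup K, IsCompact (U : Set K) ∧ IsOpen (U : Set K) ∧
         TDLC.IsInvariant (TDLC.conjAction H K hHK) (U : Set K)] ∧
    ((IsCompact (TDLC.distalResidual (TDLC.conjAction H K hHK) : Set K) ∨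
      IsCompact (TDLC.discreteResidual (TDLC.conjAction H K hHK) : Set K) ∨
      ∃ U : Subgroup K, IsCompact (U : Set K) ∧ IsOpen (U : Set K) ∧
         TDLC.IsInvariant (TDLC.conjAction H K hHK) (U : Set K)) →
      TDLC.IsFlat (TDLC.conjAction H K hHK) ∧
      TDLC.nub (TDLC.conjAction H K hHK) = TDLC.discreteResidual (TDLC.conjAction H K hHK) ∧
      TDLC.discreteResidual (TDLC.conjAction H K hHK) =
        TDLC.residualInfty (TDLC.conjAction H K hHK) ∧
      TDLC.residualInfty (TDLC.conjAction H K hHK) =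
        TDLC.distalResidual (TDLC.conjAction H K hHK) ∧
      TDLC.IsErgodicOn (TDLC.conjAction H K hHK) (TDLC.nub (TDLC.conjAction H K hHK)) ∧
      (TopologicalSpace.MetrizableSpace (TDLC.nub (TDLC.conjAction H K hHK)) →
        TDLC.nub (TDLC.conjAction H K hHK) =
          TDLC.oneDistalResidual (TDLC.conjAction H K hHK))) := by
  obtain ⟨N, hNn, -, hSIN, hcg⟩ := hN
  have : LocallyCompactSpace K := hK.isClosedEmbedding_subtypeVal.locallyCompactSpace
  have : LocallyCompactSpace H := hH.isClosedEmbedding_subtypeVal.locallyCompactSpace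
  obtain ⟨S, hS⟩ := TDLC.exists_isEquicontinuousGenerating hSIN hcg
  have hφ : ∀ h, Continuous (TDLC.conjAction H K hHK h) := TDLC.continuous_conjAction
  -- From here on only continuity and equicontinuous generation of the action matter.
  generalize TDLC.conjAction H K hHK = φ at hS hφ ⊢
  have htfae : List.TFAE
      [IsCompact (TDLC.distalResidual φ : Set K), IsCompact (TDLC.discreteResidual φ : Set K),
       ∃ U : Subgroup K, IsCompact (U : Set K) ∧ IsOpen (U : Set K) ∧
         TDLC.IsInvariant φ (U : Set K)] := by
    tfae_have 1 → 2 := fun h => by rwa [TDLC.discreteResidual_eq_distalResidual hφ hS h]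
    tfae_have 2 → 3 := fun h => by
      obtain ⟨W, hWc, hWo, hW, -⟩ := TDLC.exists_compact_open_invariant_le hS h
        isOpen_univ (Set.subset_univ _)
      exact ⟨W, hWc, hWo, hW⟩
    tfae_have 3 → 1 := fun ⟨U, hUc, hUo, hU⟩ =>
      (TDLC.isCompact_discreteResidual hUc hUo hU).of_isClosed_subset
        TDLC.isClosed_distalResidual TDLC.distalResidual_le_discreteResidual
    tfae_finish
  refine ⟨htfae, fun hany => ?_⟩
  have hthree : ∃ U : Subgroup K, IsCompact (U : Set K) ∧ IsOpen (U : Set K) ∧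
      TDLC.IsInvariant φ (U : Set K) := by
    rcases hany with h | h | h
    · exact (htfae.out 0 2).1 h
    · exact (htfae.out 1 2).1 h
    · exact h
  have hdist : IsCompact (TDLC.distalResidual φ : Set K) := (htfae.out 0 2).2 hthree
  obtain ⟨U, hUc, hUo, hU⟩ := hthree
  have hres : IsCompact (TDLC.discreteResidual φ : Set K) :=
    TDLC.isCompact_discreteResidual hUc hUo hU
  have hnub := TDLC.nub_eq_discreteResidual hφ hS hUc hUo hU
  have hinfty := TDLC.discreteResidual_eq_residualInfty hS hres
  have heq := TDLC.discreteResidual_eq_distalResidual hφ hS hdist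
  have herg := TDLC.isErgodicOn_discreteResidual hφ hS hres
  refine ⟨⟨U, TDLC.isTidyFor_of_isInvariant hUc hUo hU⟩, hnub, hinfty, hinfty.symm.trans heq, ?_⟩
  rw [hnub]
  refine ⟨herg, fun hmetr => le_antisymm (le_sInf fun D hD => ?_) ?_⟩
  · exact herg.le_of_isDistalAtOneOn hφ hres hD.1 hD.2.2
  · rw [heq]
    exact TDLC.oneDistalResidual_le_distalResidual
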